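/- Let $G$ be a finite simple graph with no induced subgraph isomorphic to $2K_2$ (the disjoint union of two edges). Let $\Delta$, $\omega$, $\chi$ denote its maximum degree, clique number and chromatic number. Then at least one of the following holds. (0) $\chi \le \max\{\omega, \Delta-1\}$. (1) $\Delta \le 3$, $\omega = 2$, $\chi = 3$, and $G$ contains an induced cycle of odd length. (2) $\Delta = 4 = \chi$, $\omega = 3$, and the graph obtained from $G$ by deleting its isolated vertices (this is $G$ itself if $G$ is connected) is isomorphic to one of the following four graphs: - $A$: vertices $0,\dots,6$ and edges $45,46,56,14,15,24,26,35,36,01,02,03$; - $B$: the graph $A$ with the additional edge $23$; - $C$: the complement of the cycle $C_7$; - $D$: the graph $A$ with an additional vertex $7$ and the additional edges $71,72,73$. -/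

import Mathlib

open scoped SimpleGraph

/-- `2K₂`, the disjoint union of two edges. -/
abbrev twoK2 : SimpleGraph (Fin 2 ⊕ Fin 2) :=
  (⊤ : SimpleGraph (Fin 2)) ⊕g (⊤ : SimpleGraph (Fin 2))

/-- `G` has no induced subgraph isomorphic to `2K₂`. -/
def TwoK2Free {V : Type*} (G : SimpleGraph V) : Prop :=
  ¬ twoK2.IsIndContained G

/-- `G` has an induced cycle of odd length. -/
def HasInducedOddCycle {V : Type*} (G : SimpleGraph V) : Prop :=
  ∃ n : ℕ, 3 ≤ n ∧ Odd n ∧ (SimpleGraph.cycleGraph n).IsIndContained G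

/-- The triangle `4,5,6`, vertices `1,2,3` each joined to a different pair of its vertices,
and a vertex `0` joined to `1,2,3`: 7 vertices, 12 edges. -/
def exceptionA : SimpleGraph (Fin 7) :=
  SimpleGraph.fromEdgeSet
    {s(4, 5), s(4, 6), s(5, 6), s(1, 4), s(1, 5), s(2, 4), s(2, 6), s(3, 5), s(3, 6),
      s(0, 1), s(0, 2), s(0, 3)}

/-- `exceptionA` with the additional edge `23`: 7 vertices, 13 edges. -/
def exceptionB : SimpleGraph (Fin 7) :=
  SimpleGraph.fromEdgeSet
    {s(4, 5), s(4, 6), s(5, 6), s(1, 4), s(1, 5), s(2, 4), s(2, 6), s(3, 5), s(3, 6),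
      s(0, 1), s(0, 2), s(0, 3), s(2, 3)}

/-- The complement of the 7-cycle: 7 vertices, 14 edges. -/
def exceptionC : SimpleGraph (Fin 7) :=
  (SimpleGraph.cycleGraph 7)ᶜ

/-- `exceptionA` with a second vertex `7` joined to `1,2,3`: 8 vertices, 15 edges. -/
def exceptionD : SimpleGraph (Fin 8) :=
  SimpleGraph.fromEdgeSet
    {s(4, 5), s(4, 6), s(5, 6), s(1, 4), s(1, 5), s(2, 4), s(2, 6), s(3, 5), s(3, 6),
      s(0, 1), s(0, 2), s(0, 3), s(7, 1), s(7, 2), s(7, 3)}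

/-- `G` is isomorphic to one of the exceptional graphs. -/
def IsExceptional {V : Type*} (G : SimpleGraph V) : Prop :=
  Nonempty (G ≃g exceptionA) ∨ Nonempty (G ≃g exceptionB) ∨
    Nonempty (G ≃g exceptionC) ∨ Nonempty (G ≃g exceptionD)

/-!
Let `q ≥ 4` and let `G` be `2K₂`-free with `Δ ≤ q + 1` and `ω ≤ q`; then `G` is `q`-colourable, by
induction on `q`. Two disjoint `q`-cliques can be matched along non-edges, and the matching extends
to a `q`-colouring. If there are no two such cliques, then all `q`-cliques share a vertex, and using
a maximal independent set through it as a colour class lowers both `Δ` and `ω` by one.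

This reduces everything to `Δ ≤ 4` and `ω ≤ 3`. There, for a triangle `a`, `b`, `c`, the vertices
adjacent to `c` but not to `a`, to `a` but not to `b`, and to `b` but not to `c` are natural colour
classes. If they fail to give a 3-colouring, the bound on the degrees forces one of the four
exceptional graphs. When an exceptional graph is what remains after deleting a maximal independent
set `I` from a graph with `Δ ≤ 5`, one of its vertices of degree 4 can trade places with its only
neighbour in `I` so that three colours suffice for the rest.
-/

section Basics

variable {V : Type*} {G : SimpleGraph V}

theorem TwoK2Free.adj_cross (hG : TwoK2Free G) {a b c d : V} (hab : G.Adj a b)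
    (hcd : G.Adj c d) : G.Adj a c ∨ G.Adj a d ∨ G.Adj b c ∨ G.Adj b d := by
  by_contra! h
  obtain ⟨hac, had, hbc, hbd⟩ := h
  have nac : a ≠ c := by rintro rfl; exact had hcd
  have nad : a ≠ d := by rintro rfl; exact hac hcd.symm
  have nbc : b ≠ c := by rintro rfl; exact hbd hcd
  have nbd : b ≠ d := by rintro rfl; exact hbc hcd.symm
  have nab := hab.ne
  have ncd := hcd.ne
  refine hG ⟨⟨⟨Sum.elim ![a, b] ![c, d], ?_⟩, ?_⟩⟩
  · rintro (i | i) (j | j) h <;> fin_cases i <;> fin_cases j <;> simp_all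
  · change ∀ {i j}, G.Adj (Sum.elim ![a, b] ![c, d] i) (Sum.elim ![a, b] ![c, d] j) ↔ _
    rintro (i | i) (j | j) <;> fin_cases i <;> fin_cases j <;>
      simp_all [SimpleGraph.adj_comm]

theorem TwoK2Free.induce (hG : TwoK2Free G) (s : Set V) : TwoK2Free (G.induce s) :=
  fun h => hG (h.trans ⟨SimpleGraph.Embedding.induce s⟩)

theorem TwoK2Free.isIndepSet_nonadj (hG : TwoK2Free G) {a b : V} (hab : G.Adj a b) :
    G.IsIndepSet {v | ¬ G.Adj a v ∧ ¬ G.Adj b v} := by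
  rintro s ⟨has, hbs⟩ t ⟨hat, hbt⟩ - hst
  rcases hG.adj_cross hab hst with h | h | h | h <;> contradiction

theorem isIndepSet_pair {a b : V} (hab : ¬ G.Adj a b) : G.IsIndepSet {a, b} :=
  Set.pairwise_pair.2 fun _ => ⟨hab, fun hba => hab hba.symm⟩

theorem not_adj_of_cliqueFree_three (h : G.CliqueFree 3) {a b c : V} (hab : G.Adj a b)
    (hac : G.Adj a c) : ¬ G.Adj b c := by
  classical
  exact fun hbc => h {a, b, c} (SimpleGraph.is3Clique_triple_iff.2 ⟨hab, hac, hbc⟩)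

theorem not_adj_of_cliqueFree_four (h : G.CliqueFree 4) {a b c d : V} (hab : G.Adj a b)
    (hac : G.Adj a c) (had : G.Adj a d) (hbc : G.Adj b c) (hbd : G.Adj b d) : ¬ G.Adj c d := by
  classical
  intro hcd
  refine h _ ((SimpleGraph.is3Clique_triple_iff.2 ⟨hbc, hbd, hcd⟩).insert (a := a) fun t ht => ?_)
  simp only [Finset.mem_insert, Finset.mem_singleton] at ht
  rcases ht with rfl | rfl | rfl <;> assumption

/-- Every vertex of `G` has at most `k` neighbours. Counting the neighbours in finite sets avoids
local finiteness assumptions. -/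
def DegreeAtMost (G : SimpleGraph V) (k : ℕ) : Prop :=
  ∀ (v : V) (T : Finset V), (∀ t ∈ T, G.Adj v t) → T.card ≤ k

variable {k l : ℕ}

theorem DegreeAtMost.mono (h : DegreeAtMost G k) (hkl : k ≤ l) : DegreeAtMost G l :=
  fun v T hT => (h v T hT).trans hkl

theorem degreeAtMost_maxDegree [Fintype V] [DecidableRel G.Adj] : DegreeAtMost G G.maxDegree :=
  fun v _ hT => le_trans (Finset.card_le_card fun t ht => (G.mem_neighborFinset v t).2 (hT t ht))
    (G.degree_le_maxDegree v)

theorem DegreeAtMost.card_le_succ (hd : DegreeAtMost G k) (v : V) (T : Finset V)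
    (hT : ∀ t ∈ T, t ≠ v → G.Adj v t) : T.card ≤ k + 1 := by
  classical
  have := hd v (T.erase v) fun t ht => hT t (Finset.mem_of_mem_erase ht) (Finset.ne_of_mem_erase ht)
  have := Finset.pred_card_le_card_erase (s := T) (a := v)
  omega

theorem DegreeAtMost.mem_of_adj (hd : DegreeAtMost G k) {v w : V} {T : Finset V}
    (hT : ∀ t ∈ T, G.Adj v t) (hk : k ≤ T.card) (hvw : G.Adj v w) : w ∈ T := by
  classical
  by_contra hw
  have := hd v (insert w T) (Finset.forall_mem_insert _ _ _ |>.2 ⟨hvw, hT⟩)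
  rw [Finset.card_insert_of_notMem hw] at this
  omega

theorem DegreeAtMost.eq_of_adj_four (hd : DegreeAtMost G 4) {v t₁ t₂ t₃ t₄ w : V}
    (h₁ : G.Adj v t₁) (h₂ : G.Adj v t₂) (h₃ : G.Adj v t₃) (h₄ : G.Adj v t₄)
    (hne : [t₁, t₂, t₃, t₄].Nodup) (hvw : G.Adj v w) : w = t₁ ∨ w = t₂ ∨ w = t₃ ∨ w = t₄ := by
  classical
  have hw : w ∈ [t₁, t₂, t₃, t₄].toFinset :=
    hd.mem_of_adj (by simp [h₁, h₂, h₃, h₄]) (List.toFinset_card_of_nodup hne).ge hvw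
  simpa using hw

theorem DegreeAtMost.exists_of_adj_hom {W : Type*} {F : SimpleGraph W} (hd : DegreeAtMost G k)
    (f : F →g G) (hf : Function.Injective f) (i : W) [Fintype (F.neighborSet i)]
    (hi : k ≤ F.degree i) {v : V} (hv : G.Adj (f i) v) : ∃ j, F.Adj i j ∧ f j = v := by
  have := hd.mem_of_adj (T := (F.neighborFinset i).map ⟨f, hf⟩)
    (by simpa using fun j hj => f.map_adj hj) (by simpa using hi) hv
  simpa using this

theorem DegreeAtMost.degree_le_of_hom {W : Type*} {F : SimpleGraph W} (hd : DegreeAtMost G k)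
    (f : F →g G) (hf : Function.Injective f) (i : W) [Fintype (F.neighborSet i)] :
    F.degree i ≤ k := by
  simpa using hd (f i) ((F.neighborFinset i).map ⟨f, hf⟩) (by simpa using fun j hj => f.map_adj hj)

theorem DegreeAtMost.induce_compl (h : DegreeAtMost G (k + 1)) {I : Set V}
    (hI : ∀ v ∉ I, ∃ y ∈ I, G.Adj v y) : DegreeAtMost (G.induce Iᶜ) k := by
  classical
  rintro ⟨v, hv⟩ T hT
  obtain ⟨y, hy, hvy⟩ := hI v hv
  have hyT : y ∉ T.map (Function.Embedding.subtype _) := by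
    simp only [Finset.mem_map, not_exists, not_and]
    rintro ⟨t, ht⟩ - rfl
    exact ht hy
  have := h v (insert y (T.map (Function.Embedding.subtype _)))
    (Finset.forall_mem_insert _ _ _ |>.2 ⟨hvy, by simpa using fun t ht htT => hT ⟨t, ht⟩ htT⟩)
  rw [Finset.card_insert_of_notMem hyT, Finset.card_map] at this
  omega

theorem exists_isIndepSet_dominating [Finite V] {J : Set V} (hJ : G.IsIndepSet J) :
    ∃ I, J ⊆ I ∧ G.IsIndepSet I ∧ ∀ v ∉ I, ∃ y ∈ I, G.Adj v y := by
  obtain ⟨I, hJI, hI⟩ := (Set.toFinite {I | G.IsIndepSet I}).exists_le_maximal hJ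
  refine ⟨I, hJI, hI.prop, fun v hv => ?_⟩
  by_contra! hy
  have hvI : G.IsIndepSet (insert v I) :=
    hI.prop.insert fun w hw _ => ⟨hy w hw, fun h => hy w hw h.symm⟩
  exact hv (hI.le_of_ge hvI (Set.subset_insert v I) (Set.mem_insert v I))

end Basics

section Coloring

variable {V α : Type*} {G : SimpleGraph V}

/- Each vertex of `Z` takes a colour whose class contains none of its neighbours; no two vertices
of `Z` conflict because `Z` is independent. -/
theorem nonempty_coloring_of_isIndepSet {X : α → Set V} {Z : Set V} (hX : ∀ i, G.IsIndepSet (X i))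
    (hZ : G.IsIndepSet Z) (hcover : ∀ v ∉ Z, ∃ i, v ∈ X i)
    (hfree : ∀ z ∈ Z, ∃ i, ∀ w ∈ X i, ¬ G.Adj z w) : Nonempty (G.Coloring α) := by
  have hcolor : ∀ v, ∃ i, (v ∉ Z → v ∈ X i) ∧ (v ∈ Z → ∀ w ∈ X i, ¬ G.Adj v w) := by
    intro v
    by_cases hv : v ∈ Z
    · exact (hfree v hv).imp fun i hi => ⟨fun h => absurd hv h, fun _ => hi⟩
    · exact (hcover v hv).imp fun i hi => ⟨fun _ => hi, fun h => absurd h hv⟩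
  choose c hcX hcZ using hcolor
  refine ⟨SimpleGraph.Coloring.mk c fun {v w} hvw hc => ?_⟩
  by_cases hv : v ∈ Z <;> by_cases hw : w ∈ Z
  · exact hZ hv hw hvw.ne hvw
  · exact hcZ v hv w (hc ▸ hcX w hw) hvw
  · exact hcZ w hw v (hc ▸ hcX v hv) hvw.symm
  · exact hX (c w) (hc ▸ hcX v hv) (hcX w hw) hvw.ne hvw

theorem colorable_of_isIndepSet_cover {n : ℕ} {X : Fin n → Set V} (hX : ∀ i, G.IsIndepSet (X i))
    (hcover : ∀ v, ∃ i, v ∈ X i) : G.Colorable n :=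
  nonempty_coloring_of_isIndepSet hX (Z := ∅) (by simp) (fun v _ => hcover v) (by simp)

/- `h` trades places with its only neighbour `y` in `I`: the new colour class is `I - y + h`. -/
theorem nonempty_coloring_option {X : α → Set V} {I : Set V} {h y : V}
    (hX : ∀ i, G.IsIndepSet (X i)) (hI : G.IsIndepSet I) (hcover : ∀ v ∉ I, v ≠ h → ∃ i, v ∈ X i)
    (hy : ∀ w ∈ I, G.Adj h w → w = y) {i : α} (hi : ∀ w ∈ X i, ¬ G.Adj y w) :
    Nonempty (G.Coloring (Option α)) := by
  have hnone : G.IsIndepSet (insert h (I \ {y})) :=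
    (hI.mono Set.sdiff_subset).insert fun w hw _ =>
      ⟨fun hhw => hw.2 (hy w hw.1 hhw), fun hwh => hw.2 (hy w hw.1 hwh.symm)⟩
  refine nonempty_coloring_of_isIndepSet (X := fun o => o.elim (insert h (I \ {y})) X) (Z := {y})
    (Option.rec hnone hX) (by simp) (fun v hv => ?_) fun z hz => ⟨some i, hz ▸ hi⟩
  by_cases hvh : v = h
  · exact ⟨none, .inl hvh⟩
  by_cases hvI : v ∈ I
  · exact ⟨none, .inr ⟨hvI, hv⟩⟩
  · exact (hcover v hvI hvh).elim fun j hj => ⟨some j, hj⟩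

theorem colorable_succ_of_induce_compl {k : ℕ} {I : Set V} (hI : G.IsIndepSet I)
    (h : (G.induce Iᶜ).Colorable k) : G.Colorable (k + 1) := by
  obtain ⟨c⟩ := h
  let X : Option (Fin k) → Set V := fun o => o.elim I fun i => Subtype.val '' {v | c v = i}
  have hX : ∀ o, G.IsIndepSet (X o) := by
    rintro (_ | i)
    · exact hI
    · rintro _ ⟨v, rfl, rfl⟩ _ ⟨w, hw, rfl⟩ - hvw
      exact c.valid hvw hw.symm
  have hcover : ∀ v, ∃ o, v ∈ X o := by
    intro v
    by_cases hv : v ∈ I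
    · exact ⟨none, hv⟩
    · exact ⟨some (c ⟨v, hv⟩), ⟨v, hv⟩, rfl, rfl⟩
  obtain ⟨d⟩ :=
    nonempty_coloring_of_isIndepSet hX (Z := ∅) (by simp) (fun v _ => hcover v) (by simp)
  simpa using d.colorable

end Coloring

section TriangleFree

variable {V : Type*} {G : SimpleGraph V}

theorem TwoK2Free.colorable_three_of_cliqueFree_three (hG : TwoK2Free G) (h3 : G.CliqueFree 3) :
    G.Colorable 3 := by
  rcases eq_or_ne G ⊥ with rfl | hne
  · exact ⟨SimpleGraph.Coloring.mk (fun _ => 0) nofun⟩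
  obtain ⟨u, v, huv⟩ := SimpleGraph.ne_bot_iff_exists_adj.1 hne
  refine colorable_of_isIndepSet_cover
    (X := ![G.neighborSet u, G.neighborSet v, {z | ¬ G.Adj u z ∧ ¬ G.Adj v z}]) ?_ fun w => ?_
  · simpa [Fin.forall_fin_succ] using
      ⟨G.isIndepSet_neighborSet_of_triangleFree h3 u, G.isIndepSet_neighborSet_of_triangleFree h3 v,
        hG.isIndepSet_nonadj huv⟩
  · simp only [Fin.exists_fin_succ, Matrix.cons_val_zero, Matrix.cons_val_succ,
      Matrix.cons_val_fin_one, SimpleGraph.mem_neighborSet, Set.mem_ofPred_eq, exists_const]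
    tauto

theorem isIndContained_cycleGraph_five {v₀ v₁ v₂ v₃ v₄ : V} (h₀₁ : G.Adj v₀ v₁)
    (h₁₂ : G.Adj v₁ v₂) (h₂₃ : G.Adj v₂ v₃) (h₃₄ : G.Adj v₃ v₄) (h₄₀ : G.Adj v₄ v₀)
    (h₀₂ : ¬ G.Adj v₀ v₂) (h₁₃ : ¬ G.Adj v₁ v₃) (h₂₄ : ¬ G.Adj v₂ v₄) (h₃₀ : ¬ G.Adj v₃ v₀)
    (h₄₁ : ¬ G.Adj v₄ v₁) : (SimpleGraph.cycleGraph 5).IsIndContained G := by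
  let f : Fin 5 → V := ![v₀, v₁, v₂, v₃, v₄]
  have hadj : ∀ i j, G.Adj (f i) (f j) ↔ (SimpleGraph.cycleGraph 5).Adj i j := by
    intro i j
    rw [SimpleGraph.cycleGraph_adj]
    fin_cases i <;> fin_cases j <;> simp_all +decide [f, SimpleGraph.adj_comm]
  -- No two vertices of the 5-cycle have the same neighbours.
  have htwin : ∀ i j, (∀ k, (SimpleGraph.cycleGraph 5).Adj i k ↔
      (SimpleGraph.cycleGraph 5).Adj j k) → i = j := by
    simp only [SimpleGraph.cycleGraph_adj]
    decide
  exact ⟨⟨⟨f, fun i j hij => htwin i j fun k => by rw [← hadj, ← hadj, hij]⟩, hadj _ _⟩⟩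

theorem TwoK2Free.colorable_two (hG : TwoK2Free G) (h3 : G.CliqueFree 3)
    (h5 : ¬ (SimpleGraph.cycleGraph 5).IsIndContained G) : G.Colorable 2 := by
  rcases eq_or_ne G ⊥ with rfl | hne
  · exact ⟨SimpleGraph.Coloring.mk (fun _ => 0) nofun⟩
  obtain ⟨u, v, huv⟩ := SimpleGraph.ne_bot_iff_exists_adj.1 hne
  refine nonempty_coloring_of_isIndepSet (X := ![G.neighborSet u, G.neighborSet v])
    (Z := {z | ¬ G.Adj u z ∧ ¬ G.Adj v z}) ?_ (hG.isIndepSet_nonadj huv) (fun w hw => ?_) ?_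
  · simpa [Fin.forall_fin_succ] using
      ⟨G.isIndepSet_neighborSet_of_triangleFree h3 u, G.isIndepSet_neighborSet_of_triangleFree h3 v⟩
  · simpa [Fin.exists_fin_succ, or_iff_not_imp_left] using hw
  · rintro z ⟨huz, hvz⟩
    by_contra! hz
    obtain ⟨a, hua : G.Adj u a, hza⟩ := hz 0
    obtain ⟨b, hvb : G.Adj v b, hzb⟩ := hz 1
    exact h5 <| isIndContained_cycleGraph_five huv hvb hzb.symm hza hua.symm
      (not_adj_of_cliqueFree_three h3 huv.symm hvb) hvz (not_adj_of_cliqueFree_three h3 hzb hza)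
      (mt .symm huz) (not_adj_of_cliqueFree_three h3 hua huv)

end TriangleFree

section Fans

variable {V : Type*} {G : SimpleGraph V} {a b c p q u v w x y z t : V}

/-- A triangle `a`, `b`, `c`, three tips `x`, `y`, `w` joined to different pairs of its vertices,
and a top `z` joined to the tips: a copy of `exceptionA` that is not necessarily induced. -/
structure CappedSun (G : SimpleGraph V) (a b c x y w z : V) : Prop where
  ab : G.Adj a b
  ac : G.Adj a c
  bc : G.Adj b c
  ax : G.Adj a x
  bx : G.Adj b x
  ay : G.Adj a y
  cy : G.Adj c y
  bw : G.Adj b w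
  cw : G.Adj c w
  xz : G.Adj x z
  yz : G.Adj y z
  wz : G.Adj w z
  c_ne_x : c ≠ x
  b_ne_y : b ≠ y
  a_ne_w : a ≠ w

/-- The vertices `c`, `b`, `p`, `u` form, in this order, an induced path in the neighbourhood of
`a`. In a triangle `a`, `b`, `c` this is what keeps the neighbours of `a` that are not neighbours
of `c` from being independent. -/
structure IsFan (G : SimpleGraph V) (a b c p u : V) : Prop where
  ab : G.Adj a b
  ac : G.Adj a c
  ap : G.Adj a p
  au : G.Adj a u
  cb : G.Adj c b
  bp : G.Adj b p
  pu : G.Adj p u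
  not_cp : ¬ G.Adj c p
  not_bu : ¬ G.Adj b u
  not_cu : ¬ G.Adj c u

/- If `st` is such an edge, then `b` is adjacent to exactly one of `s` and `t`: otherwise
`a`, `b`, `s`, `t` is a clique or `bc`, `st` is a `2K₂`. -/
theorem TwoK2Free.isIndepSet_of_not_isFan (hG : TwoK2Free G) (h4 : G.CliqueFree 4)
    (hab : G.Adj a b) (hac : G.Adj a c) (hbc : G.Adj b c) (hF : ¬ ∃ p u, IsFan G a b c p u) :
    G.IsIndepSet {v | ¬ G.Adj c v ∧ G.Adj a v} := by
  rintro s ⟨hcs, has⟩ t ⟨hct, hat⟩ - hst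
  have hK4 : G.Adj b s → ¬ G.Adj b t := fun hbs hbt =>
    not_adj_of_cliqueFree_four h4 hab has hat hbs hbt hst
  by_cases hbs : G.Adj b s
  · exact hF ⟨s, t, hab, hac, has, hat, hbc.symm, hbs, hst, hcs, hK4 hbs, hct⟩
  by_cases hbt : G.Adj b t
  · exact hF ⟨t, s, hab, hac, hat, has, hbc.symm, hbt, hst.symm, hct, hbs, hcs⟩
  rcases hG.adj_cross hbc hst with h | h | h | h <;> contradiction

theorem TwoK2Free.colorable_three_or_cappedSun_of_not_isFan (hG : TwoK2Free G)
    (h4 : G.CliqueFree 4) (hab : G.Adj a b) (hac : G.Adj a c) (hbc : G.Adj b c)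
    (hFa : ¬ ∃ p u, IsFan G a c b p u) (hFb : ¬ ∃ p u, IsFan G b a c p u)
    (hFc : ¬ ∃ p u, IsFan G c b a p u) :
    G.Colorable 3 ∨ ∃ x y w z, CappedSun G a b c x y w z := by
  rw [or_iff_not_imp_right]
  intro hsun
  have hXa := hG.isIndepSet_of_not_isFan h4 hbc.symm hac.symm hab.symm hFc
  have hXb := hG.isIndepSet_of_not_isFan h4 hac hab hbc.symm hFa
  have hXc := hG.isIndepSet_of_not_isFan h4 hab.symm hbc hac hFb
  refine nonempty_coloring_of_isIndepSet (X := ![{v | ¬ G.Adj a v ∧ G.Adj c v},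
    {v | ¬ G.Adj b v ∧ G.Adj a v}, {v | ¬ G.Adj c v ∧ G.Adj b v}])
    (Z := {v | ¬ G.Adj a v ∧ ¬ G.Adj b v ∧ ¬ G.Adj c v}) ?_
    (fun s hs t ht => hG.isIndepSet_nonadj hab ⟨hs.1, hs.2.1⟩ ⟨ht.1, ht.2.1⟩) (fun v hv => ?_) ?_
  · intro i
    fin_cases i
    exacts [hXa, hXb, hXc]
  · have := not_adj_of_cliqueFree_four h4 hab hac (d := v)
    simp only [Fin.exists_fin_succ, Matrix.cons_val_zero, Matrix.cons_val_succ,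
      Matrix.cons_val_fin_one, Set.mem_ofPred_eq, not_and, not_not, exists_const] at hv ⊢
    tauto
  · rintro z ⟨haz, hbz, hcz⟩
    by_contra! hz
    obtain ⟨w, ⟨haw, hcw⟩, hzw⟩ := hz 0
    obtain ⟨y, ⟨hby, hay⟩, hzy⟩ := hz 1
    obtain ⟨x, ⟨hcx, hbx⟩, hzx⟩ := hz 2
    have hbw : G.Adj b w := by have := hG.adj_cross hab hzw; tauto
    have hcy : G.Adj c y := by have := hG.adj_cross hbc hzy; tauto
    have hax : G.Adj a x := by have := hG.adj_cross hac hzx; tauto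
    exact hsun ⟨x, y, w, z, hab, hac, hbc, hax, hbx, hay, hcy, hbw, hcw, hzx.symm, hzy.symm,
      hzw.symm, by rintro rfl; exact hcz hzx.symm, by rintro rfl; exact hbz hzy.symm,
      by rintro rfl; exact haz hzw.symm⟩

theorem IsFan.nodup (h : IsFan G a b c p u) : [c, b, p, u].Nodup := by
  have hcp : c ≠ p := by rintro rfl; exact h.not_cu h.pu
  have hcu : c ≠ u := by rintro rfl; exact h.not_bu h.cb.symm
  have hbu : b ≠ u := by rintro rfl; exact h.not_cu h.cb
  simp [h.cb.ne, h.bp.ne, h.pu.ne, hcp, hcu, hbu]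

theorem IsFan.eq_of_adj (h : IsFan G a b c p u) (hd : DegreeAtMost G 4) (hat : G.Adj a t) :
    t = c ∨ t = b ∨ t = p ∨ t = u :=
  hd.eq_of_adj_four h.ac h.ab h.ap h.au h.nodup hat

theorem IsFan.not_isFan_swap (h : IsFan G a b c p u) (hd : DegreeAtMost G 4) :
    ¬ IsFan G a c b q v := by
  intro h'
  rcases h.eq_of_adj hd h'.ap with rfl | rfl | rfl | rfl
  · exact G.irrefl h'.bp
  · exact h'.not_cu h'.pu
  · exact h.not_cp h'.bp
  · exact h.not_cu h'.bp

theorem TwoK2Free.colorable_three_or_cappedSun_of_isFan_hubs (hG : TwoK2Free G)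
    (hd : DegreeAtMost G 4) (h : IsFan G a b c p u) (h' : IsFan G b a c q w) :
    G.Colorable 3 ∨ ∃ a b c x y w z, CappedSun G a b c x y w z := by
  obtain rfl : q = p := by
    rcases h.eq_of_adj hd h'.bp with rfl | rfl | rfl | rfl
    · exact absurd h'.pu h'.not_cu
    · exact absurd h'.ap G.irrefl
    · rfl
    · exact absurd h'.ap h.not_bu
  have haw : a ≠ w := by rintro rfl; exact h'.not_cu h.ac.symm
  have hbu : b ≠ u := by rintro rfl; exact h.not_cu h.cb
  have hcp : c ≠ q := by rintro rfl; exact h.not_cu h.pu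
  have huw : u ≠ w := by rintro rfl; exact h.not_bu h'.au
  rw [or_iff_not_imp_right]
  intro hsun
  refine nonempty_coloring_of_isIndepSet (X := ![{a, w}, {b, u}, {c, q}])
    (Z := {v | ¬ G.Adj a v ∧ ¬ G.Adj b v}) ?_ (hG.isIndepSet_nonadj h.ab) (fun v hv => ?_) ?_
  · intro i
    fin_cases i
    exacts [isIndepSet_pair h'.not_bu, isIndepSet_pair h.not_bu, isIndepSet_pair h.not_cp]
  · have hav := h.eq_of_adj hd (t := v)
    have hbv := h'.eq_of_adj hd (t := v)
    simp only [Fin.exists_fin_succ, Matrix.cons_val_zero, Matrix.cons_val_succ,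
      Matrix.cons_val_fin_one, Set.mem_ofPred_eq, Set.mem_insert_iff, Set.mem_singleton_iff,
      not_and, not_not, exists_const] at hv ⊢
    tauto
  · rintro z ⟨haz, hbz⟩
    by_contra! hz
    have hzw : G.Adj z w := by simpa [mt G.adj_symm haz] using hz 0
    have hzu : G.Adj z u := by simpa [mt G.adj_symm hbz] using hz 1
    have hzq : ¬ G.Adj q z := by
      intro hqz
      rcases hd.eq_of_adj_four h.ap.symm h.bp.symm h.pu h'.pu
        (by simp [h.ab.ne, h.au.ne, haw, hbu, h'.au.ne, huw]) hqz with rfl | rfl | rfl | rfl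
      · exact hbz h.ab.symm
      · exact haz h.ab
      · exact G.irrefl hzu
      · exact G.irrefl hzw
    have hzc : G.Adj z c := by simpa [mt G.adj_symm hzq] using hz 2
    exact hsun ⟨a, b, q, c, u, w, z, h.ab, h.ap, h.bp, h.ac, h.cb.symm, h.au, h.pu, h'.au, h'.pu,
      hzc.symm, hzu.symm, hzw.symm, hcp.symm, hbu, haw⟩

theorem IsFan.eq_of_adj_of_not_adj (h : IsFan G a b c p u) (hd : DegreeAtMost G 4)
    (hat : G.Adj a t) (hbt : ¬ G.Adj b t) (htb : t ≠ b) : t = u := by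
  rcases h.eq_of_adj hd hat with rfl | rfl | rfl | rfl
  exacts [absurd h.cb.symm hbt, absurd rfl htb, absurd h.bp hbt, rfl]

theorem TwoK2Free.colorable_three_or_adj_of_isFan_spokes (hG : TwoK2Free G) (hd : DegreeAtMost G 4)
    (h : IsFan G a b c p u) (h' : IsFan G c b a q v) : G.Colorable 3 ∨ G.Adj u v := by
  rw [or_iff_not_imp_right]
  intro huv
  have hN : ∀ t, G.Adj b t → t = a ∨ t = c ∨ t = p ∨ t = q := by
    have haq : a ≠ q := by rintro rfl; exact h'.not_cu h'.pu
    have hcp : c ≠ p := by rintro rfl; exact h.not_cu h.pu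
    have hpq : p ≠ q := by rintro rfl; exact h.not_cp h'.ap
    exact fun t => hd.eq_of_adj_four h.ab.symm h.cb.symm h.bp h'.bp (by
      simp [h.ac.ne, h.ap.ne, haq, hcp, h'.ap.ne, hpq])
  have hindep : G.IsIndepSet {v | ¬ G.Adj b v} := by
    intro s hbs t hbt _ hst
    have hsb : s ≠ b := by rintro rfl; exact hbt hst
    have htb : t ≠ b := by rintro rfl; exact hbs hst.symm
    have hu : s = u ∨ t = u :=
      (hG.adj_cross h.ab hst).elim (fun has => .inl (h.eq_of_adj_of_not_adj hd has hbs hsb))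
        fun H => .inr (h.eq_of_adj_of_not_adj hd (by tauto) hbt htb)
    have hv : s = v ∨ t = v :=
      (hG.adj_cross h'.ab hst).elim (fun hcs => .inl (h'.eq_of_adj_of_not_adj hd hcs hbs hsb))
        fun H => .inr (h'.eq_of_adj_of_not_adj hd (by tauto) hbt htb)
    have hne : u ≠ v := by rintro rfl; exact h.not_cu h'.au
    rcases hu with rfl | rfl <;> rcases hv with rfl | rfl
    exacts [hne rfl, huv hst, huv hst.symm, hne rfl]
  refine colorable_of_isIndepSet_cover (X := ![{a, q}, {c, p}, {v | ¬ G.Adj b v}]) ?_ fun t => ?_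
  · intro i
    fin_cases i
    exacts [isIndepSet_pair h'.not_cp, isIndepSet_pair h.not_cp, hindep]
  · have := hN t
    simp only [Fin.exists_fin_succ, Matrix.cons_val_zero, Matrix.cons_val_succ,
      Matrix.cons_val_fin_one, Set.mem_ofPred_eq, Set.mem_insert_iff, Set.mem_singleton_iff,
      exists_const]
    tauto

end Fans

section Exceptions

instance : DecidableRel exceptionA.Adj := by unfold exceptionA; infer_instance

instance : DecidableRel exceptionB.Adj := by unfold exceptionB; infer_instance

instance : DecidableRel exceptionC.Adj := by unfold exceptionC; infer_instance

instance : DecidableRel exceptionD.Adj := by unfold exceptionD; infer_instance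

variable {V W : Type*} {G : SimpleGraph V} {F : SimpleGraph W} {k : ℕ}

theorem DegreeAtMost.adj_of_adj_hom (hd : DegreeAtMost G k) (f : F →g G)
    (hf : Function.Injective f) {i j : W} [Fintype (F.neighborSet i)] (hi : k ≤ F.degree i)
    (hij : G.Adj (f i) (f j)) : F.Adj i j := by
  obtain ⟨j', hij', hj'⟩ := hd.exists_of_adj_hom f hf i hi hij
  exact hf hj' ▸ hij'

/- An edge from `f i` to a vertex outside the copy of `F` would form a `2K₂` with the image of
an edge of `F` whose ends are saturated and not adjacent to `i`. -/
theorem TwoK2Free.exists_of_adj_hom (hG : TwoK2Free G) (hd : DegreeAtMost G k) (f : F →g G)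
    (hf : Function.Injective f) [F.LocallyFinite] {i : W}
    (hi : k ≤ F.degree i ∨ ∃ p q, F.Adj p q ∧ k ≤ F.degree p ∧ k ≤ F.degree q ∧ ¬ F.Adj p i ∧
      ¬ F.Adj q i ∧ ∀ j, F.Adj p j ∨ F.Adj q j → F.Adj i j ∨ k ≤ F.degree j)
    {v : V} (hv : G.Adj (f i) v) : ∃ j, F.Adj i j ∧ f j = v := by
  obtain hi | ⟨p, q, hpq, hp, hq, hpi, hqi, hN⟩ := hi
  · exact hd.exists_of_adj_hom f hf i hi hv
  have hv' : ∃ j, (F.Adj p j ∨ F.Adj q j) ∧ f j = v := by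
    rcases hG.adj_cross (f.map_adj hpq) hv with h | h | h | h
    · exact absurd (hd.adj_of_adj_hom f hf hp h) hpi
    · exact (hd.exists_of_adj_hom f hf p hp h).imp fun j hj => ⟨.inl hj.1, hj.2⟩
    · exact absurd (hd.adj_of_adj_hom f hf hq h) hqi
    · exact (hd.exists_of_adj_hom f hf q hq h).imp fun j hj => ⟨.inr hj.1, hj.2⟩
  obtain ⟨j, hj, rfl⟩ := hv'
  refine ⟨j, ?_, rfl⟩
  exact (hN j hj).elim id fun hdeg => (hd.adj_of_adj_hom f hf hdeg hv.symm).symm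

theorem TwoK2Free.nonempty_induce_support_iso (hG : TwoK2Free G) (f : F →g G)
    (hf : Function.Injective f) {i₀ j₀ : W} (h₀ : F.Adj i₀ j₀) (hF : ∀ i, ∃ j, F.Adj i j)
    (hsat : ∀ i v, G.Adj (f i) v → ∃ j, F.Adj i j ∧ f j = v) :
    Nonempty (G.induce G.support ≃g F) := by
  have hrange : ∀ v ∈ G.support, ∃ i, f i = v := by
    rintro v ⟨w, hvw⟩
    have hadj : (∃ i, G.Adj (f i) v) ∨ ∃ i, G.Adj (f i) w := by
      rcases hG.adj_cross (f.map_adj h₀) hvw with h | h | h | h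
      exacts [.inl ⟨_, h⟩, .inr ⟨_, h⟩, .inl ⟨_, h⟩, .inr ⟨_, h⟩]
    obtain ⟨i, hi⟩ | ⟨i, hi⟩ := hadj
    · exact (hsat i v hi).imp fun j hj => hj.2
    · obtain ⟨j, -, rfl⟩ := hsat i w hi
      exact (hsat j v hvw.symm).imp fun j hj => hj.2
  have hsupp : ∀ i, f i ∈ G.support := fun i =>
    (hF i).elim fun _ hij => (f.map_adj hij).mem_support_left
  have hbij : Function.Bijective fun i => (⟨f i, hsupp i⟩ : G.support) :=
    ⟨fun i j hij => hf (Subtype.ext_iff.1 hij),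
      fun v => (hrange v v.2).imp fun i hi => Subtype.ext hi⟩
  refine ⟨RelIso.symm ⟨Equiv.ofBijective _ hbij, fun {i j} => ⟨fun hij => ?_, f.map_adj⟩⟩⟩
  obtain ⟨j', hij', hj'⟩ := hsat i (f j) hij
  exact hf hj' ▸ hij'

theorem adj_of_fromEdgeSet_adj {S : Set (Sym2 W)} {f : W → V} (hS : ∀ e ∈ S, e.map f ∈ G.edgeSet)
    {i j : W} (hij : (SimpleGraph.fromEdgeSet S).Adj i j) : G.Adj (f i) (f j) :=
  hS _ ((SimpleGraph.fromEdgeSet_adj S).1 hij).1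

theorem TwoK2Free.nonempty_iso_exceptionB (hG : TwoK2Free G) (hd : DegreeAtMost G 4)
    (f : exceptionB →g G) (hf : Function.Injective f) :
    Nonempty (G.induce G.support ≃g exceptionB) :=
  hG.nonempty_induce_support_iso f hf (i₀ := 0) (j₀ := 1) (by decide) (by decide) fun i v =>
    hG.exists_of_adj_hom hd f hf (by revert i; decide)

theorem TwoK2Free.nonempty_iso_exceptionC (hG : TwoK2Free G) (hd : DegreeAtMost G 4)
    (f : exceptionC →g G) (hf : Function.Injective f) :
    Nonempty (G.induce G.support ≃g exceptionC) :=
  hG.nonempty_induce_support_iso f hf (i₀ := 0) (j₀ := 2) (by decide) (by decide) fun i v =>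
    hG.exists_of_adj_hom hd f hf (by revert i; decide)

theorem TwoK2Free.nonempty_iso_exceptionD (hG : TwoK2Free G) (hd : DegreeAtMost G 4)
    (f : exceptionD →g G) (hf : Function.Injective f) :
    Nonempty (G.induce G.support ≃g exceptionD) :=
  hG.nonempty_induce_support_iso f hf (i₀ := 0) (j₀ := 1) (by decide) (by decide) fun i v =>
    hG.exists_of_adj_hom hd f hf (by revert i; decide)

end Exceptions

section MaxDegreeFour

variable {V : Type*} {G : SimpleGraph V} {a b c p q u v w x y z t : V}

theorem CappedSun.swap_ab (h : CappedSun G a b c x y w z) : CappedSun G b a c x w y z :=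
  ⟨h.ab.symm, h.bc, h.ac, h.bx, h.ax, h.bw, h.cw, h.ay, h.cy, h.xz, h.wz, h.yz, h.c_ne_x,
    h.a_ne_w, h.b_ne_y⟩

theorem CappedSun.swap_bc (h : CappedSun G a b c x y w z) : CappedSun G a c b y x w z :=
  ⟨h.ac, h.ab, h.bc.symm, h.ay, h.cy, h.ax, h.bx, h.cw, h.bw, h.yz, h.xz, h.wz, h.b_ne_y,
    h.c_ne_x, h.a_ne_w⟩

theorem CappedSun.nodup (h : CappedSun G a b c x y w z) (h4 : G.CliqueFree 4) :
    [z, x, y, w, a, b, c].Nodup := by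
  have hcx : ¬ G.Adj c x := not_adj_of_cliqueFree_four h4 h.ab h.ac h.ax h.bc h.bx
  have hby : ¬ G.Adj b y := not_adj_of_cliqueFree_four h4 h.ac h.ab h.ay h.bc.symm h.cy
  have haw : ¬ G.Adj a w :=
    not_adj_of_cliqueFree_four h4 h.bc h.ab.symm h.bw h.ac.symm h.cw
  have hza : z ≠ a := by rintro rfl; exact haw h.wz.symm
  have hzb : z ≠ b := by rintro rfl; exact hby h.yz.symm
  have hzc : z ≠ c := by rintro rfl; exact hcx h.xz.symm
  have hxy : x ≠ y := by rintro rfl; exact hcx h.cy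
  have hxw : x ≠ w := by rintro rfl; exact hcx h.cw
  have hyw : y ≠ w := by rintro rfl; exact hby h.bw
  simp [h.xz.ne', h.yz.ne', h.wz.ne', hza, hzb, hzc, hxy, hxw, h.ax.ne', h.bx.ne', h.c_ne_x.symm,
    hyw, h.ay.ne', h.b_ne_y.symm, h.cy.ne', h.a_ne_w.symm, h.bw.ne', h.cw.ne', h.ab.ne, h.ac.ne,
    h.bc.ne]

theorem injective_of_nodup_ofFn {α : Type*} {n : ℕ} {f : Fin n → α} {l : List α}
    (hl : l.Nodup) (hf : List.ofFn f = l) : Function.Injective f :=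
  List.nodup_ofFn.1 (hf ▸ hl)

theorem CappedSun.nonempty_iso_exceptionB (h : CappedSun G a b c x y w z) (hyw : G.Adj y w)
    (hG : TwoK2Free G) (hd : DegreeAtMost G 4) (h4 : G.CliqueFree 4) :
    Nonempty (G.induce G.support ≃g exceptionB) := by
  refine hG.nonempty_iso_exceptionB hd ⟨![z, x, y, w, a, b, c], fun {i j} hij =>
    adj_of_fromEdgeSet_adj ?_ hij⟩ (injective_of_nodup_ofFn (h.nodup h4) (by simp))
  simp [h.ab, h.ac, h.bc, h.ax.symm, h.bx.symm, h.ay.symm, h.cy.symm, h.bw.symm, h.cw.symm,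
    h.xz.symm, h.yz.symm, h.wz.symm, hyw]

theorem CappedSun.nonempty_iso_exceptionD (h : CappedSun G a b c x y w z)
    (h' : CappedSun G a b c x y w t) (htz : t ≠ z) (hG : TwoK2Free G) (hd : DegreeAtMost G 4)
    (h4 : G.CliqueFree 4) : Nonempty (G.induce G.support ≃g exceptionD) := by
  have hnodup : [t, z, x, y, w, a, b, c].Nodup := by
    refine List.nodup_cons.2 ⟨?_, h.nodup h4⟩
    simpa [htz] using (List.nodup_cons.1 (h'.nodup h4)).1
  refine hG.nonempty_iso_exceptionD hd ⟨![z, x, y, w, a, b, c, t], fun {i j} hij =>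
    adj_of_fromEdgeSet_adj ?_ hij⟩
    (injective_of_nodup_ofFn ((List.perm_append_singleton t _).nodup_iff.2 hnodup) (by simp))
  simp [h.ab, h.ac, h.bc, h.ax.symm, h.bx.symm, h.ay.symm, h.cy.symm, h.bw.symm, h.cw.symm,
    h.xz.symm, h.yz.symm, h.wz.symm, h'.xz.symm, h'.yz.symm, h'.wz.symm]

theorem CappedSun.eq_of_adj_c (h : CappedSun G a b c x y w z) (hd : DegreeAtMost G 4)
    (h4 : G.CliqueFree 4) (hct : G.Adj c t) : t = a ∨ t = b ∨ t = y ∨ t = w := by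
  have := h.nodup h4
  refine hd.eq_of_adj_four h.ac.symm h.bc.symm h.cy h.cw ?_ hct
  simp only [List.nodup_cons, List.mem_cons, List.not_mem_nil] at this ⊢
  tauto

theorem CappedSun.eq_or_cappedSun_of_adj_x (h : CappedSun G a b c x y w z) (hG : TwoK2Free G)
    (hd : DegreeAtMost G 4) (h4 : G.CliqueFree 4) (hxy : ¬ G.Adj x y) (hxw : ¬ G.Adj x w)
    (hxt : G.Adj x t) : t = a ∨ t = b ∨ CappedSun G a b c x y w t := by
  have hcx : ¬ G.Adj c x := not_adj_of_cliqueFree_four h4 h.ab h.ac h.ax h.bc h.bx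
  by_cases hct : G.Adj c t
  · rcases h.eq_of_adj_c hd h4 hct with rfl | rfl | rfl | rfl
    exacts [.inl rfl, .inr (.inl rfl), absurd hxt hxy, absurd hxt hxw]
  have hyt : G.Adj y t := by
    have := hG.adj_cross hxt h.cy.symm
    simp_all [G.adj_comm]
  have hwt : G.Adj w t := by
    have := hG.adj_cross hxt h.cw.symm
    simp_all [G.adj_comm]
  exact .inr (.inr { h with xz := hxt, yz := hyt, wz := hwt })

theorem CappedSun.nonempty_iso_exceptionA (h : CappedSun G a b c x y w z) (hxy : ¬ G.Adj x y)
    (hxw : ¬ G.Adj x w) (hyw : ¬ G.Adj y w) (htop : ∀ t, CappedSun G a b c x y w t → t = z)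
    (hG : TwoK2Free G) (hd : DegreeAtMost G 4) (h4 : G.CliqueFree 4) :
    Nonempty (G.induce G.support ≃g exceptionA) := by
  let f : exceptionA →g G := ⟨![z, x, y, w, a, b, c], fun {i j} hij => by
    refine adj_of_fromEdgeSet_adj ?_ hij
    simp [h.ab, h.ac, h.bc, h.ax.symm, h.bx.symm, h.ay.symm, h.cy.symm, h.bw.symm, h.cw.symm,
      h.xz.symm, h.yz.symm, h.wz.symm]⟩
  have hf : Function.Injective f := injective_of_nodup_ofFn (h.nodup h4) (by simp [f])
  refine hG.nonempty_induce_support_iso f hf (i₀ := 0) (j₀ := 1) (by decide) (by decide)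
    fun i t hit => ?_
  by_cases hi : i = 1 ∨ i = 2 ∨ i = 3
  · rcases hi with rfl | rfl | rfl
    · rcases h.eq_or_cappedSun_of_adj_x hG hd h4 hxy hxw hit with rfl | rfl | ht
      exacts [⟨4, by decide, rfl⟩, ⟨5, by decide, rfl⟩, ⟨0, by decide, (htop t ht).symm⟩]
    · rcases h.swap_bc.eq_or_cappedSun_of_adj_x hG hd h4 (mt .symm hxy) hyw hit with
        rfl | rfl | ht
      exacts [⟨4, by decide, rfl⟩, ⟨6, by decide, rfl⟩, ⟨0, by decide, (htop t ht.swap_bc).symm⟩]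
    · rcases h.swap_ab.swap_bc.eq_or_cappedSun_of_adj_x hG hd h4 (mt .symm hxw) (mt .symm hyw)
        hit with rfl | rfl | ht
      exacts [⟨5, by decide, rfl⟩, ⟨6, by decide, rfl⟩,
        ⟨0, by decide, (htop t ht.swap_bc.swap_ab).symm⟩]
  · exact hG.exists_of_adj_hom hd f hf (by clear hit; revert i; decide) hit

theorem CappedSun.isExceptional (h : CappedSun G a b c x y w z) (hG : TwoK2Free G)
    (hd : DegreeAtMost G 4) (h4 : G.CliqueFree 4) : IsExceptional (G.induce G.support) := by
  by_cases hyw : G.Adj y w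
  · exact .inr (.inl (h.nonempty_iso_exceptionB hyw hG hd h4))
  by_cases hxw : G.Adj x w
  · exact .inr (.inl (h.swap_bc.nonempty_iso_exceptionB hxw hG hd h4))
  by_cases hxy : G.Adj x y
  · exact .inr (.inl (h.swap_ab.swap_bc.nonempty_iso_exceptionB hxy hG hd h4))
  by_cases htop : ∀ t, CappedSun G a b c x y w t → t = z
  · exact .inl (h.nonempty_iso_exceptionA hxy hxw hyw htop hG hd h4)
  · push Not at htop
    obtain ⟨t, h', htz⟩ := htop
    exact .inr (.inr (.inr (h.nonempty_iso_exceptionD h' htz hG hd h4)))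

theorem IsFan.nonempty_iso_exceptionC (h : IsFan G a b c p u) (h' : IsFan G c b a q v)
    (huv : G.Adj u v) (hpq : ¬ G.Adj p q) (hG : TwoK2Free G) (hd : DegreeAtMost G 4) :
    Nonempty (G.induce G.support ≃g exceptionC) := by
  have huq : G.Adj u q := by
    have := hG.adj_cross h.pu h'.ap
    simp_all [G.adj_comm, h.not_cp, h.not_cu]
  have hpv : G.Adj p v := by
    have := hG.adj_cross h.ap h'.pu
    simp_all [G.adj_comm, h'.not_cp, h'.not_cu]
  have haq : a ≠ q := by rintro rfl; exact h'.not_cu h'.pu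
  have hqp : q ≠ p := by rintro rfl; exact h.not_cp h'.ap
  have hpc : p ≠ c := by rintro rfl; exact h.not_cu h.pu
  have hcu : c ≠ u := by rintro rfl; exact h.not_bu h.cb.symm
  have hub : u ≠ b := by rintro rfl; exact h.not_cu h.cb
  have hbv : b ≠ v := by rintro rfl; exact h'.not_cu h.ab
  have hva : v ≠ a := by rintro rfl; exact h'.not_bu h.ab.symm
  have hnodup : [a, q, p, c, u, b, v].Nodup := by
    simp [haq, hqp, hpc, hcu, hub, hbv, hva.symm, h.ap.ne, h.ac.ne, h.au.ne, h.ab.ne, h'.ap.ne',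
      huq.ne', h'.bp.ne', h'.pu.ne, h.pu.ne, h.bp.ne', hpv.ne, h.cb.ne, h'.au.ne, huv.ne]
  have hadj : ∀ i j, exceptionC.Adj i j →
      G.Adj (![a, q, p, c, u, b, v] i) (![a, q, p, c, u, b, v] j) := by
    intro i j hij
    fin_cases i <;> fin_cases j <;> first
      | exact absurd hij (by decide)
      | simp [h.ab, h.ac, h.ap, h.au, h.cb, h.bp, h.pu, h'.ap, h'.au, h'.bp, h'.pu, huq, hpv, huv,
          h.ab.symm, h.ac.symm, h.ap.symm, h.au.symm, h.cb.symm, h.bp.symm, h.pu.symm,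
          h'.ap.symm, h'.au.symm, h'.bp.symm, h'.pu.symm, huq.symm, hpv.symm, huv.symm]
  exact hG.nonempty_iso_exceptionC hd ⟨_, hadj _ _⟩ (injective_of_nodup_ofFn hnodup (by simp))

theorem TwoK2Free.colorable_three_or_isExceptional_of_isFan_spokes (hG : TwoK2Free G)
    (hd : DegreeAtMost G 4) (h4 : G.CliqueFree 4) (h : IsFan G a b c p u)
    (h' : IsFan G c b a q v) : G.Colorable 3 ∨ IsExceptional (G.induce G.support) := by
  refine (hG.colorable_three_or_adj_of_isFan_spokes hd h h').imp_right fun huv => ?_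
  by_cases hpq : G.Adj p q
  · have hsun : CappedSun G a b p c u q v :=
      ⟨h.ab, h.ap, h.bp, h.ac, h.cb.symm, h.au, h.pu, h'.bp, hpq, h'.au, huv, h'.pu,
        by rintro rfl; exact h.not_cu h.pu, by rintro rfl; exact h.not_cu h.cb,
        by rintro rfl; exact h'.not_cu h'.pu⟩
    exact hsun.isExceptional hG hd h4
  · exact .inr (.inr (.inl (h.nonempty_iso_exceptionC h' huv hpq hG hd)))

theorem TwoK2Free.colorable_three_or_isExceptional_of_isFan_hubs (hG : TwoK2Free G)
    (hd : DegreeAtMost G 4) (h4 : G.CliqueFree 4) (h : IsFan G a b c p u)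
    (h' : IsFan G b a c q w) : G.Colorable 3 ∨ IsExceptional (G.induce G.support) :=
  (hG.colorable_three_or_cappedSun_of_isFan_hubs hd h h').imp_right
    fun ⟨_, _, _, _, _, _, _, hsun⟩ => hsun.isExceptional hG hd h4

theorem TwoK2Free.colorable_three_or_isExceptional (hG : TwoK2Free G) (hd : DegreeAtMost G 4)
    (h4 : G.CliqueFree 4) : G.Colorable 3 ∨ IsExceptional (G.induce G.support) := by
  classical
  by_cases h3 : G.CliqueFree 3
  · exact .inl (hG.colorable_three_of_cliqueFree_three h3)
  simp only [SimpleGraph.CliqueFree, not_forall, not_not, SimpleGraph.is3Clique_iff] at h3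
  obtain ⟨-, a, b, c, hab, hac, hbc, -⟩ := h3
  by_contra hcon
  have hubs : ∀ {a b c p u q w}, IsFan G a b c p u → ¬ IsFan G b a c q w := fun h h' =>
    hcon (hG.colorable_three_or_isExceptional_of_isFan_hubs hd h4 h h')
  have spokes : ∀ {a b c p u q v}, IsFan G a b c p u → ¬ IsFan G c b a q v := fun h h' =>
    hcon (hG.colorable_three_or_isExceptional_of_isFan_spokes hd h4 h h')
  have fan : ∀ {a b c}, G.Adj a b → G.Adj a c → G.Adj b c →
      (∃ p u, IsFan G a c b p u) ∨ (∃ p u, IsFan G b a c p u) ∨ ∃ p u, IsFan G c b a p u := by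
    intro a b c hab hac hbc
    by_contra! h
    refine hcon ((hG.colorable_three_or_cappedSun_of_not_isFan h4 hab hac hbc
      (by simpa using h.1) (by simpa using h.2.1) (by simpa using h.2.2)).imp_right ?_)
    exact fun ⟨_, _, _, _, hsun⟩ => hsun.isExceptional hG hd h4
  rcases fan hab hac hbc with ⟨p, u, h⟩ | ⟨p, u, h⟩ | ⟨p, u, h⟩ <;>
    rcases fan hac hab hbc.symm with ⟨q, v, h'⟩ | ⟨q, v, h'⟩ | ⟨q, v, h'⟩ <;>
    first
      | exact h.not_isFan_swap hd h'
      | exact hubs h h'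
      | exact spokes h h'

end MaxDegreeFour

section Traces

/-- The properties shared by the traces `{i | G.Adj y (f i)}`, `y ∈ I`, of a maximal independent
set `I` of a graph `G` with maximum degree at most 5 that is not 4-colourable, on a copy `f` of
`F` that contains all edges of `G - I`. -/
structure IsTraceFamily {W : Type*} (F : SimpleGraph W) [F.LocallyFinite]
    (𝒮 : Set (Finset W)) : Prop where
  card_le : ∀ S ∈ 𝒮, S.card ≤ 5
  adj_cross : ∀ S ∈ 𝒮, ∀ s ∈ S, ∀ i j, F.Adj i j → i ∈ S ∨ j ∈ S ∨ F.Adj s i ∨ F.Adj s j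
  exists_mem : ∀ h, 4 ≤ F.degree h → ∃ S ∈ 𝒮, h ∈ S
  eq_of_mem : ∀ h, 4 ≤ F.degree h → ∀ S ∈ 𝒮, ∀ T ∈ 𝒮, h ∈ S → h ∈ T → S = T
  meets : ∀ S ∈ 𝒮, ∀ h ∈ S, ∀ K L M : Finset W, (4 ≤ F.degree h ∧ F.IsIndepSet K ∧
    F.IsIndepSet L ∧ F.IsIndepSet M ∧ ∀ i, i = h ∨ i ∈ K ∨ i ∈ L ∨ i ∈ M) → ∃ s ∈ K, s ∈ S

variable {V W : Type*} {G : SimpleGraph V} {F : SimpleGraph W} {I : Set V}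

theorem exists_embedding_of_iso_support
    (e : (G.induce Iᶜ).induce (G.induce Iᶜ).support ≃g F) :
    ∃ f : F ↪g G, (∀ i, f i ∉ I) ∧ ∀ v ∉ I, v ∉ Set.range f → ∀ w ∉ I, ¬ G.Adj v w := by
  refine ⟨((SimpleGraph.Embedding.induce Iᶜ).comp (SimpleGraph.Embedding.induce _)).comp
    e.symm.toEmbedding, fun i => (e.symm i).1.2, fun v hv hvf w hw hvw => hvf ?_⟩
  have hsupp : (⟨v, hv⟩ : (Iᶜ : Set V)) ∈ (G.induce Iᶜ).support := ⟨⟨w, hw⟩, hvw⟩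
  exact ⟨e ⟨_, hsupp⟩, congrArg (fun v => v.1.1) (e.symm_apply_apply ⟨_, hsupp⟩)⟩

theorem eq_of_adj_of_degree [F.LocallyFinite] (hd : DegreeAtMost G 5) (f : F ↪g G)
    (hfI : ∀ i, f i ∉ I) {h : W} (hh : 4 ≤ F.degree h) {y z : V} (hy : y ∈ I) (hz : z ∈ I)
    (hhy : G.Adj (f h) y) (hhz : G.Adj (f h) z) : z = y := by
  classical
  let T := insert y ((F.neighborFinset h).map f.toEmbedding)
  have hyT : y ∉ (F.neighborFinset h).map f.toEmbedding := by
    rw [Finset.mem_map]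
    rintro ⟨i, -, rfl⟩
    exact hfI i hy
  have hzT : z ∈ T := by
    refine hd.mem_of_adj ?_ ?_ hhz
    · simp [T, hhy]
    · rw [Finset.card_insert_of_notMem hyT]
      simpa using hh
  rcases Finset.mem_insert.1 hzT with hzy | hz'
  · exact hzy
  · obtain ⟨i, -, rfl⟩ := Finset.mem_map.1 hz'
    exact absurd hz (hfI i)

theorem colorable_four_of_not_meets [F.LocallyFinite] (hd : DegreeAtMost G 5)
    (hI : G.IsIndepSet I) (f : F ↪g G) (hfI : ∀ i, f i ∉ I)
    (hisol : ∀ v ∉ I, v ∉ Set.range f → ∀ w ∉ I, ¬ G.Adj v w) {y : V} (hy : y ∈ I) {h : W}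
    (hh : 4 ≤ F.degree h) (hhy : G.Adj (f h) y) {K L M : Set W} (hK : F.IsIndepSet K)
    (hL : F.IsIndepSet L) (hM : F.IsIndepSet M) (hcover : ∀ i, i = h ∨ i ∈ K ∨ i ∈ L ∨ i ∈ M)
    (hyK : ∀ s ∈ K, ¬ G.Adj y (f s)) : G.Colorable 4 := by
  have himage : ∀ {K : Set W}, F.IsIndepSet K → G.IsIndepSet (f '' K) := by
    rintro K hK _ ⟨i, hi, rfl⟩ _ ⟨j, hj, rfl⟩ hij hadj
    exact hK hi hj (ne_of_apply_ne f hij) (f.map_adj_iff.1 hadj)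
  have hisolated : G.IsIndepSet (f '' L ∪ {v | v ∉ I ∧ v ∉ Set.range f}) := by
    rintro s (hs | hs) t (ht | ht) hst
    · exact himage hL hs ht hst
    · obtain ⟨i, -, rfl⟩ := hs
      exact fun hadj => hisol t ht.1 ht.2 _ (hfI i) hadj.symm
    · obtain ⟨i, -, rfl⟩ := ht
      exact hisol s hs.1 hs.2 _ (hfI i)
    · exact hisol s hs.1 hs.2 t ht.1
  have hcoverG : ∀ v ∉ I, v ≠ f h →
      ∃ i, v ∈ ![f '' K, f '' L ∪ {v | v ∉ I ∧ v ∉ Set.range f}, f '' M] i := by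
    intro v hvI hvh
    by_cases hv : v ∈ Set.range f
    · obtain ⟨i, rfl⟩ := hv
      rcases hcover i with rfl | hi | hi | hi
      exacts [absurd rfl hvh, ⟨0, i, hi, rfl⟩, ⟨1, .inl ⟨i, hi, rfl⟩⟩, ⟨2, i, hi, rfl⟩]
    · exact ⟨1, .inr ⟨hvI, hv⟩⟩
  obtain ⟨d⟩ := nonempty_coloring_option (h := f h) (y := y) (i := 0)
    (X := ![f '' K, f '' L ∪ {v | v ∉ I ∧ v ∉ Set.range f}, f '' M])
    (by intro i; fin_cases i; exacts [himage hK, hisolated, himage hM]) hI hcoverG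
    (fun w hw hhw => eq_of_adj_of_degree hd f hfI hh hy hw hhy hhw)
    (by rintro _ ⟨s, hs, rfl⟩; exact hyK s hs)
  simpa using d.colorable

theorem TwoK2Free.exists_isTraceFamily [Finite W] [F.LocallyFinite] (hG : TwoK2Free G)
    (hd : DegreeAtMost G 5) (hcol : ¬ G.Colorable 4) (hI : G.IsIndepSet I)
    (hdom : ∀ v ∉ I, ∃ y ∈ I, G.Adj v y)
    (e : (G.induce Iᶜ).induce (G.induce Iᶜ).support ≃g F) : ∃ 𝒮, IsTraceFamily F 𝒮 := by
  classical
  cases nonempty_fintype W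
  obtain ⟨f, hfI, hisol⟩ := exists_embedding_of_iso_support e
  refine ⟨{S | ∃ y ∈ I, S = Finset.univ.filter fun i => G.Adj y (f i)}, ?_, ?_, ?_, ?_, ?_⟩
  · rintro _ ⟨y, -, rfl⟩
    simpa using hd y ((Finset.univ.filter fun i => G.Adj y (f i)).map f.toEmbedding) (by simp)
  · rintro _ ⟨y, -, rfl⟩ s hs i j hij
    simpa using hG.adj_cross (Finset.mem_filter.1 hs).2 (f.map_adj_iff.2 hij)
  · intro h _
    obtain ⟨y, hy, hhy⟩ := hdom (f h) (hfI h)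
    exact ⟨_, ⟨y, hy, rfl⟩, by simpa using hhy.symm⟩
  · rintro h hh _ ⟨y, hy, rfl⟩ _ ⟨z, hz, rfl⟩ hhy hhz
    rw [eq_of_adj_of_degree hd f hfI hh hy hz (Finset.mem_filter.1 hhy).2.symm
      (Finset.mem_filter.1 hhz).2.symm]
  · rintro _ ⟨y, hy, rfl⟩ h hhy K L M ⟨hh, hK, hL, hM, hcover⟩
    by_contra! hyK
    exact hcol (colorable_four_of_not_meets hd hI f hfI hisol hy hh
      (Finset.mem_filter.1 hhy).2.symm hK hL hM hcover (by simpa using hyK))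

theorem IsTraceFamily.not_subset [F.LocallyFinite] {𝒮 : Set (Finset W)} (h : IsTraceFamily F 𝒮)
    {S T : Finset W} (hS : S ∈ 𝒮) (s i j : W) (hT : 5 ≤ T.card ∧ s ∈ T ∧ i ∉ T ∧ j ∉ T ∧
      F.Adj i j ∧ ¬ F.Adj s i ∧ ¬ F.Adj s j) : ¬ T ⊆ S := by
  intro hTS
  obtain ⟨hcard, hs, hi, hj, hij, hsi, hsj⟩ := hT
  obtain rfl : T = S := Finset.eq_of_subset_of_card_le hTS ((h.card_le S hS).trans hcard)
  have := h.adj_cross T hS s hs i j hij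
  tauto

theorem IsTraceFamily.not_exceptionA {𝒮 : Set (Finset (Fin 7))} : ¬ IsTraceFamily exceptionA 𝒮 := by
  intro h
  obtain ⟨S, hS, h4⟩ := h.exists_mem 4 (by decide)
  have h5 : 5 ∈ S := by simpa using h.meets S hS 4 h4 {5} {6, 0} {3, 2, 1} (by decide)
  have h6 : 6 ∈ S := by simpa using h.meets S hS 4 h4 {6} {5, 0} {3, 2, 1} (by decide)
  have h32 : 3 ∈ S ∨ 2 ∈ S := by simpa using h.meets S hS 4 h4 {3, 2} {5, 0} {6, 1} (by decide)
  have h31 : 3 ∈ S ∨ 1 ∈ S := by simpa using h.meets S hS 4 h4 {3, 1} {6, 0} {5, 2} (by decide)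
  have h21 : 2 ∈ S ∨ 1 ∈ S := by simpa using h.meets S hS 5 h5 {2, 1} {4, 3} {6, 0} (by decide)
  have h32' := h.not_subset (T := {4, 5, 6, 3, 2}) hS 6 1 0 (by decide)
  have h31' := h.not_subset (T := {4, 5, 6, 3, 1}) hS 5 2 0 (by decide)
  have h21' := h.not_subset (T := {4, 5, 6, 2, 1}) hS 4 3 0 (by decide)
  simp only [Finset.insert_subset_iff, Finset.singleton_subset_iff] at h32' h31' h21'
  tauto

theorem IsTraceFamily.not_exceptionD {𝒮 : Set (Finset (Fin 8))} : ¬ IsTraceFamily exceptionD 𝒮 := by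
  intro h
  obtain ⟨S, hS, h4⟩ := h.exists_mem 4 (by decide)
  have h5 : 5 ∈ S := by simpa using h.meets S hS 4 h4 {5} {6, 0, 7} {3, 2, 1} (by decide)
  have h6 : 6 ∈ S := by simpa using h.meets S hS 4 h4 {6} {5, 0, 7} {3, 2, 1} (by decide)
  have h32 : 3 ∈ S ∨ 2 ∈ S := by
    simpa using h.meets S hS 4 h4 {3, 2} {5, 0, 7} {6, 1} (by decide)
  have h31 : 3 ∈ S ∨ 1 ∈ S := by
    simpa using h.meets S hS 4 h4 {3, 1} {6, 0, 7} {5, 2} (by decide)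
  have h21 : 2 ∈ S ∨ 1 ∈ S := by
    simpa using h.meets S hS 5 h5 {2, 1} {4, 3} {6, 0, 7} (by decide)
  have h32' := h.not_subset (T := {4, 5, 6, 3, 2}) hS 6 1 0 (by decide)
  have h31' := h.not_subset (T := {4, 5, 6, 3, 1}) hS 5 2 0 (by decide)
  have h21' := h.not_subset (T := {4, 5, 6, 2, 1}) hS 4 3 0 (by decide)
  simp only [Finset.insert_subset_iff, Finset.singleton_subset_iff] at h32' h31' h21'
  tauto

/- The second permutation is the nontrivial automorphism of `exceptionB`. -/
theorem IsTraceFamily.six_mem {𝒮 : Set (Finset (Fin 7))} (h : IsTraceFamily exceptionB 𝒮)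
    {S : Finset (Fin 7)} (hS : S ∈ 𝒮) {σ : Equiv.Perm (Fin 7)}
    (hσ : σ = 1 ∨ σ = Equiv.swap 4 5 * Equiv.swap 2 3) (h4 : σ 4 ∈ S) : 6 ∈ S := by
  by_contra h6
  have h0 : 0 ∈ S := by
    simpa [h6] using h.meets S hS _ h4 {6, 0} {σ 5, σ 2} {σ 3, 1}
      (by rcases hσ with rfl | rfl <;> decide)
  have h31 : σ 3 ∈ S ∨ 1 ∈ S := by
    simpa using h.meets S hS _ h4 {σ 3, 1} {6, 0} {σ 5, σ 2}
      (by rcases hσ with rfl | rfl <;> decide)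
  have hmem : ∀ s ∈ S, ∀ j, exceptionB.Adj 6 j ∧ ¬ exceptionB.Adj s 6 ∧ ¬ exceptionB.Adj s j →
      j ∈ S := fun s hs j ⟨h6j, hs6, hsj⟩ => by
    simpa [h6, hs6, hsj] using h.adj_cross S hS s hs 6 j h6j
  have h5 : σ 5 ∈ S := hmem 0 h0 _ (by rcases hσ with rfl | rfl <;> decide)
  have h3 : σ 3 ∈ S :=
    h31.elim id fun h1 => hmem 1 h1 _ (by rcases hσ with rfl | rfl <;> decide)
  have h1 : 1 ∈ S := by
    simpa [h6] using h.meets S hS _ h3 {6, 1} {σ 4, 0} {σ 5, σ 2}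
      (by rcases hσ with rfl | rfl <;> decide)
  have h2 : σ 2 ∈ S := hmem 1 h1 _ (by rcases hσ with rfl | rfl <;> decide)
  have hsub : {0, 1, σ 2, σ 3, σ 4, σ 5} ⊆ S := by
    simp [Finset.insert_subset_iff, h0, h1, h2, h3, h4, h5]
  have hsix : Finset.card {0, 1, σ 2, σ 3, σ 4, σ 5} = 6 := by
    rcases hσ with rfl | rfl <;> decide
  have := (Finset.card_le_card hsub).trans (h.card_le S hS)
  omega

theorem IsTraceFamily.not_exceptionB {𝒮 : Set (Finset (Fin 7))} : ¬ IsTraceFamily exceptionB 𝒮 := by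
  intro h
  obtain ⟨S, hS, h4⟩ := h.exists_mem 4 (by decide)
  have h6 : 6 ∈ S := h.six_mem hS (.inl rfl) h4
  have h5 : 5 ∈ S := by
    obtain ⟨T, hT, h5⟩ := h.exists_mem 5 (by decide)
    have h6' : 6 ∈ T := h.six_mem hT (.inr rfl) h5
    rwa [h.eq_of_mem 6 (by decide) S hS T hT h6 h6']
  have h31 : 3 ∈ S ∨ 1 ∈ S := by simpa using h.meets S hS 4 h4 {3, 1} {6, 0} {5, 2} (by decide)
  have h21 : 2 ∈ S ∨ 1 ∈ S := by simpa using h.meets S hS 5 h5 {2, 1} {6, 0} {4, 3} (by decide)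
  have h32 : 1 ∈ S → 3 ∈ S ∨ 2 ∈ S := fun h1 => by
    have hadj : ¬ exceptionB.Adj 1 3 ∧ ¬ exceptionB.Adj 1 2 := by decide
    simpa [hadj.1, hadj.2] using h.adj_cross S hS 1 h1 3 2 (by decide)
  have h32' := h.not_subset (T := {4, 5, 6, 3, 2}) hS 6 1 0 (by decide)
  have h31' := h.not_subset (T := {4, 5, 6, 3, 1}) hS 5 2 0 (by decide)
  have h21' := h.not_subset (T := {4, 5, 6, 2, 1}) hS 4 3 0 (by decide)
  simp only [Finset.insert_subset_iff, Finset.singleton_subset_iff] at h32' h31' h21'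
  tauto

theorem IsTraceFamily.not_exceptionC {𝒮 : Set (Finset (Fin 7))} : ¬ IsTraceFamily exceptionC 𝒮 := by
  intro h
  have hdeg : ∀ i, 4 ≤ exceptionC.degree i := by decide
  have hfour : ∀ S ∈ 𝒮, ∀ i ∈ S, 4 ≤ S.card := by
    intro S hS i hi
    obtain ⟨j, hj, hjS⟩ := h.meets S hS i hi {i + 1, i + 2} {i + 3, i + 4} {i + 5, i + 6}
      (by clear hi; revert i; decide)
    obtain ⟨k, hk, hkS⟩ := h.meets S hS i hi {i + 3, i + 4} {i + 1, i + 2} {i + 5, i + 6}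
      (by clear hi hj; revert i; decide)
    obtain ⟨l, hl, hlS⟩ := h.meets S hS i hi {i + 5, i + 6} {i + 1, i + 2} {i + 3, i + 4}
      (by clear hi hj hk; revert i; decide)
    have hcard : ∀ i : Fin 7, ∀ j ∈ ({i + 1, i + 2} : Finset (Fin 7)),
        ∀ k ∈ ({i + 3, i + 4} : Finset (Fin 7)), ∀ l ∈ ({i + 5, i + 6} : Finset (Fin 7)),
        Finset.card {i, j, k, l} = 4 := by decide
    rw [← hcard i j hj k hk l hl]
    exact Finset.card_le_card (by simp [Finset.insert_subset_iff, hi, hjS, hkS, hlS])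
  obtain ⟨S, hS, h0⟩ := h.exists_mem 0 (hdeg 0)
  obtain ⟨i, hi⟩ : ∃ i, i ∉ S := by
    by_contra! hall
    have := h.card_le S hS
    rw [Finset.eq_univ_iff_forall.2 hall] at this
    exact absurd this (by decide)
  obtain ⟨T, hT, hiT⟩ := h.exists_mem i (hdeg i)
  have hdisj : Disjoint S T := Finset.disjoint_left.2 fun j hjS hjT =>
    hi (h.eq_of_mem j (hdeg j) S hS T hT hjS hjT ▸ hiT)
  have hunion := Finset.card_le_univ (S ∪ T)
  rw [Finset.card_union_of_disjoint hdisj, Fintype.card_fin] at hunion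
  have := hfour S hS 0 h0
  have := hfour T hT i hiT
  omega

theorem TwoK2Free.colorable_four_of_isExceptional (hG : TwoK2Free G) (hd : DegreeAtMost G 5)
    (hI : G.IsIndepSet I) (hdom : ∀ v ∉ I, ∃ y ∈ I, G.Adj v y)
    (hexc : IsExceptional ((G.induce Iᶜ).induce (G.induce Iᶜ).support)) : G.Colorable 4 := by
  by_contra hcol
  obtain ⟨⟨e⟩⟩ | ⟨⟨e⟩⟩ | ⟨⟨e⟩⟩ | ⟨⟨e⟩⟩ := hexc
  all_goals obtain ⟨𝒮, h⟩ := hG.exists_isTraceFamily hd hcol hI hdom e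
  exacts [h.not_exceptionA, h.not_exceptionB, h.not_exceptionC, h.not_exceptionD]

end Traces

section Cliques

variable {V : Type*} {G : SimpleGraph V} {k q : ℕ} {P Q R : Finset V} {p v : V}

theorem DegreeAtMost.card_add_card_filter_adj_le [DecidableRel G.Adj] (hd : DegreeAtMost G k)
    (hP : G.IsClique (P : Set V)) (hPQ : Disjoint P Q) (hv : v ∈ P) :
    P.card + (Q.filter fun y => G.Adj v y).card ≤ k + 1 := by
  classical
  rw [← Finset.card_union_of_disjoint (hPQ.mono_right (Finset.filter_subset _ _))]
  refine hd.card_le_succ v _ fun t ht htv => ?_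
  rcases Finset.mem_union.1 ht with ht | ht
  · exact hP hv ht htv.symm
  · exact (Finset.mem_filter.1 ht).2

theorem DegreeAtMost.exists_injective_not_adj (hd : DegreeAtMost G (q + 1)) (hq : 4 ≤ q)
    (hP : G.IsNClique q P) (hQ : G.IsNClique q Q) (hPQ : Disjoint P Q) :
    ∃ φ : Q → V, Function.Injective φ ∧ ∀ y : Q, φ y ∈ P ∧ ¬ G.Adj y (φ y) := by
  classical
  suffices hall : ∀ s : Finset Q,
      s.card ≤ (s.biUnion fun y => P.filter fun x => ¬ G.Adj y x).card by
    obtain ⟨φ, hφ, h⟩ := (Finset.all_card_le_biUnion_card_iff_exists_injective _).1 hall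
    exact ⟨φ, hφ, fun y => Finset.mem_filter.1 (h y)⟩
  intro s
  rcases s.eq_empty_or_nonempty with rfl | ⟨y, hy⟩
  · simp
  by_cases hs : s.card ≤ 2
  · refine hs.trans (le_trans ?_ (Finset.card_le_card (Finset.subset_biUnion_of_mem _ hy)))
    have hnbr := hd.card_add_card_filter_adj_le hQ.isClique hPQ.symm y.2
    have hadd := Finset.card_filter_add_card_filter_not (s := P) (fun x => G.Adj y x)
    rw [hQ.card_eq] at hnbr
    rw [hP.card_eq] at hadd
    omega
  · have hsq : s.card ≤ q := by
      simpa [hQ.card_eq] using Finset.card_le_univ s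
    refine hsq.trans (hP.card_eq ▸ Finset.card_le_card fun x hx => ?_)
    by_contra hxs
    have hadj : ∀ y ∈ s, G.Adj x y := by
      simpa [hx, G.adj_comm] using hxs
    have hsub : s.map (Function.Embedding.subtype _) ⊆ Q.filter fun y => G.Adj x y := by
      intro t ht
      obtain ⟨y, hys, rfl⟩ := Finset.mem_map.1 ht
      exact Finset.mem_filter.2 ⟨y.2, hadj y hys⟩
    have hcard := Finset.card_le_card hsub
    have hnbr := hd.card_add_card_filter_adj_le hP.isClique hPQ hx
    rw [Finset.card_map] at hcard
    rw [hP.card_eq] at hnbr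
    omega

variable [DecidableEq V]

/- Two vertices of `P` with neighbours outside `P ∪ Q` would each have at most one neighbour in
`Q`, leaving an edge of `Q` that forms a `2K₂` with them. -/
theorem TwoK2Free.exists_forall_adj_mem_union (hG : TwoK2Free G) (hd : DegreeAtMost G (q + 1))
    (hq : 4 ≤ q) (hP : G.IsNClique q P) (hQ : G.IsNClique q Q) (hPQ : Disjoint P Q) :
    ∃ x₁ ∈ P, ∀ x ∈ P, x ≠ x₁ → ∀ w, G.Adj x w → w ∈ P ∪ Q := by
  classical
  by_contra! h
  obtain ⟨x₀, hx₀⟩ : P.Nonempty := by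
    rw [← Finset.card_pos, hP.card_eq]
    omega
  obtain ⟨x, hx, -, w, hxw, hw⟩ := h x₀ hx₀
  obtain ⟨x', hx', hne, w', hxw', hw'⟩ := h x hx
  have hcard : ∀ x ∈ P, ∀ w, G.Adj x w → w ∉ P ∪ Q → (Q.filter fun y => G.Adj x y).card ≤ 1 := by
    intro x hx w hxw hw
    rw [Finset.mem_union, not_or] at hw
    have := hd.card_add_card_filter_adj_le hP.isClique
      (Finset.disjoint_insert_right.2 ⟨hw.1, hPQ⟩) hx
    rw [Finset.filter_insert, if_pos hxw,
      Finset.card_insert_of_notMem (mt (Finset.mem_of_mem_filter w) hw.2), hP.card_eq] at this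
    omega
  have hunion := Finset.card_union_le (Q.filter fun y => G.Adj x y) (Q.filter fun y => G.Adj x' y)
  have hrest := Finset.le_card_sdiff
    ((Q.filter fun y => G.Adj x y) ∪ Q.filter fun y => G.Adj x' y) Q
  have hx1 := hcard x hx w hxw hw
  have hx1' := hcard x' hx' w' hxw' hw'
  rw [hQ.card_eq] at hrest
  obtain ⟨y, hy, y', hy', hyy'⟩ := Finset.one_lt_card.1 (show 1 <
    (Q \ ((Q.filter fun y => G.Adj x y) ∪ Q.filter fun y => G.Adj x' y)).card by omega)
  simp only [Finset.mem_sdiff, Finset.mem_union, Finset.mem_filter] at hy hy'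
  have := hG.adj_cross (hP.isClique hx hx' hne.symm) (hQ.isClique hy.1 hy'.1 hyy')
  tauto

theorem TwoK2Free.isIndepSet_compl_union (hG : TwoK2Free G) (hq : 4 ≤ q)
    (hP : G.IsNClique q P) {x₁ : V} (hx : ∀ x ∈ P, x ≠ x₁ → ∀ w, G.Adj x w → w ∈ P ∪ Q) :
    G.IsIndepSet {v | v ∉ P ∪ Q} := by
  obtain ⟨a, ha, b, hb, hab⟩ : ∃ a ∈ P.erase x₁, ∃ b ∈ P.erase x₁, a ≠ b := by
    have := Finset.pred_card_le_card_erase (s := P) (a := x₁)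
    rw [hP.card_eq] at this
    exact Finset.one_lt_card.1 (by omega)
  rw [Finset.mem_erase] at ha hb
  refine (hG.isIndepSet_nonadj (hP.isClique ha.2 hb.2 hab)).mono fun v hv => ?_
  exact ⟨fun hav => hv (hx a ha.2 ha.1 v hav), fun hbv => hv (hx b hb.2 hb.1 v hbv)⟩

theorem adj_of_mem_inter_of_mem_union (hP : G.IsClique (P : Set V)) (hQ : G.IsClique (Q : Set V))
    (hv : v ∈ P ∩ Q) {t : V} (ht : t ∈ P ∪ Q) (htv : t ≠ v) : G.Adj v t := by
  rw [Finset.mem_inter] at hv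
  rcases Finset.mem_union.1 ht with ht | ht
  exacts [hP hv.1 ht htv.symm, hQ hv.2 ht htv.symm]

theorem DegreeAtMost.card_union_le_of_isClique (hd : DegreeAtMost G k)
    (hP : G.IsClique (P : Set V)) (hQ : G.IsClique (Q : Set V)) (hPQ : ¬ Disjoint P Q) :
    (P ∪ Q).card ≤ k + 1 := by
  obtain ⟨v, hvP, hvQ⟩ := Finset.not_disjoint_iff.1 hPQ
  exact hd.card_le_succ v _ fun t =>
    adj_of_mem_inter_of_mem_union hP hQ (Finset.mem_inter.2 ⟨hvP, hvQ⟩)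

theorem DegreeAtMost.mem_union_of_adj (hd : DegreeAtMost G k) (hP : G.IsClique (P : Set V))
    (hQ : G.IsClique (Q : Set V)) (hcard : k + 1 ≤ (P ∪ Q).card) (hv : v ∈ P ∩ Q) {t : V}
    (hvt : G.Adj v t) : t ∈ P ∪ Q := by
  refine Finset.mem_of_mem_erase (hd.mem_of_adj (T := (P ∪ Q).erase v) (fun s hs => ?_) ?_ hvt)
  · exact adj_of_mem_inter_of_mem_union hP hQ hv (Finset.mem_of_mem_erase hs)
      (Finset.ne_of_mem_erase hs)
  · have := Finset.pred_card_le_card_erase (s := P ∪ Q) (a := v)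
    omega

theorem DegreeAtMost.disjoint_inter_of_notMem (hd : DegreeAtMost G k) (hf : G.CliqueFree (q + 1))
    (hP : G.IsClique (P : Set V)) (hQ : G.IsClique (Q : Set V)) (hcard : k + 1 ≤ (P ∪ Q).card)
    (hR : G.IsNClique q R) (hp : p ∈ P ∩ Q) (hpR : p ∉ R) : Disjoint (P ∩ Q) R := by
  obtain ⟨w, hw, hpw⟩ := hR.exists_not_adj_of_cliqueFree_succ hf p
  refine Finset.disjoint_left.2 fun p' hp' hp'R => hpw ?_
  refine adj_of_mem_inter_of_mem_union hP hQ hp ?_ (by rintro rfl; exact hpR hw)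
  by_cases hwp : w = p'
  · exact hwp ▸ Finset.inter_subset_union hp'
  · exact hd.mem_union_of_adj hP hQ hcard hp' (hR.isClique hp'R hw (Ne.symm hwp))

theorem DegreeAtMost.sdiff_subset_of_disjoint_inter (hd : DegreeAtMost G (q + 1)) (hq : 4 ≤ q)
    (hP : G.IsNClique q P) (hR : G.IsNClique q R) (hPR : ¬ Disjoint P R)
    (hcard : (P \ Q).card ≤ 2) (hdisj : Disjoint (P ∩ Q) R) : P \ Q ⊆ R := by
  have hsub : P ∩ R ⊆ P \ Q := by
    intro x hx
    rw [Finset.mem_inter] at hx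
    exact Finset.mem_sdiff.2 ⟨hx.1, fun hxQ =>
      Finset.disjoint_left.1 hdisj (Finset.mem_inter.2 ⟨hx.1, hxQ⟩) hx.2⟩
  have hunion := hd.card_union_le_of_isClique hP.isClique hR.isClique hPR
  have hadd := Finset.card_union_add_card_inter P R
  rw [hP.card_eq, hR.card_eq] at hadd
  rw [← Finset.eq_of_subset_of_card_le hsub (by omega)]
  exact Finset.inter_subset_right

/- Otherwise `R` contains `P \ Q` and `Q \ P`, so that `P ∪ Q` is a clique. -/
theorem DegreeAtMost.mem_of_mem_inter (hd : DegreeAtMost G (q + 1)) (hq : 4 ≤ q)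
    (hf : G.CliqueFree (q + 1)) (hP : G.IsNClique q P) (hQ : G.IsNClique q Q)
    (hcard : q + 2 ≤ (P ∪ Q).card) (hR : G.IsNClique q R) (hPR : ¬ Disjoint P R)
    (hQR : ¬ Disjoint Q R) (hp : p ∈ P ∩ Q) : p ∈ R := by
  by_contra hpR
  have hPQ : ¬ Disjoint P Q := Finset.not_disjoint_iff_nonempty_inter.2 ⟨p, hp⟩
  have hdisj := hd.disjoint_inter_of_notMem hf hP.isClique hQ.isClique hcard hR hp hpR
  have hunion := hd.card_union_le_of_isClique hP.isClique hQ.isClique hPQ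
  have hPadd := Finset.card_sdiff_add_card P Q
  have hQadd := Finset.card_sdiff_add_card Q P
  rw [Finset.union_comm Q P, hP.card_eq] at hQadd
  rw [hQ.card_eq] at hPadd
  have hPsub := hd.sdiff_subset_of_disjoint_inter hq hP hR hPR (by omega) hdisj
  have hQsub := hd.sdiff_subset_of_disjoint_inter hq hQ hR hQR (by omega)
    (Finset.inter_comm P Q ▸ hdisj)
  obtain ⟨y, hy⟩ : (Q \ P).Nonempty := by
    rw [← Finset.card_pos]
    omega
  obtain ⟨w, hw, hyw⟩ := hP.exists_not_adj_of_cliqueFree_succ hf y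
  have hne : y ≠ w := by rintro rfl; exact (Finset.mem_sdiff.1 hy).2 hw
  by_cases hwQ : w ∈ Q
  · exact hyw (hQ.isClique (Finset.mem_sdiff.1 hy).1 hwQ hne)
  · exact hyw (hR.isClique (hQsub hy) (hPsub (Finset.mem_sdiff.2 ⟨hw, hwQ⟩)) hne)

theorem exists_replacement_of_notMem (hf : G.CliqueFree (q + 1)) (hP : G.IsNClique q P)
    (hQ : G.IsNClique q Q) (hPQ : (P \ Q).card ≤ 1) (hp : p ∈ P) (hpQ : p ∉ Q) :
    ∃ y ∉ P, (∀ x ∈ P, x ≠ p → G.Adj y x) ∧ ¬ G.Adj y p := by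
  obtain ⟨y, hyQ, hyP⟩ : ∃ y ∈ Q, y ∉ P := by
    by_contra! h
    exact hpQ (Finset.eq_of_subset_of_card_le h (by rw [hP.card_eq, hQ.card_eq]) ▸ hp)
  have hadj : ∀ x ∈ P, x ≠ p → G.Adj y x := by
    intro x hx hxp
    refine hQ.isClique hyQ (not_not.1 fun hxQ => hxp ?_) (by rintro rfl; exact hyP hx)
    exact Finset.card_le_one.1 hPQ x (Finset.mem_sdiff.2 ⟨hx, hxQ⟩) p
      (Finset.mem_sdiff.2 ⟨hp, hpQ⟩)
  refine ⟨y, hyP, hadj, fun hyp => ?_⟩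
  obtain ⟨w, hw, hyw⟩ := hP.exists_not_adj_of_cliqueFree_succ hf y
  by_cases hwp : w = p
  · exact hyw (hwp ▸ hyp)
  · exact hyw (hadj w hw hwp)

/- If each vertex of `P` is missed by another clique, the vertices replacing the other vertices
of `P` are distinct neighbours of any given one, whose degree is then `2(q - 1) > q + 1`. -/
theorem DegreeAtMost.exists_mem_of_card_sdiff_le_one (hd : DegreeAtMost G (q + 1)) (hq : 4 ≤ q)
    (hf : G.CliqueFree (q + 1)) (hP : G.IsNClique q P)
    (hone : ∀ Q, G.IsNClique q Q → (P \ Q).card ≤ 1) : ∃ v, ∀ Q, G.IsNClique q Q → v ∈ Q := by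
  by_contra! hmiss
  have hreplace : ∀ p ∈ P, ∃ y ∉ P, (∀ x ∈ P, x ≠ p → G.Adj y x) ∧ ¬ G.Adj y p := fun p hp =>
    let ⟨Q, hQ, hpQ⟩ := hmiss p
    exists_replacement_of_notMem hf hP hQ (hone Q hQ) hp hpQ
  choose! y hyP hyadj hynadj using hreplace
  obtain ⟨p, hp⟩ : P.Nonempty := by
    rw [← Finset.card_pos, hP.card_eq]
    omega
  have hinj : Set.InjOn y (P.erase p) := by
    intro a ha b hb hab
    rw [Finset.mem_coe, Finset.mem_erase] at ha hb
    by_contra hne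
    exact hynadj b hb.2 (hab ▸ hyadj a ha.2 b hb.2 (Ne.symm hne))
  have hdisj : Disjoint P ((P.erase p).image y) := by
    rw [Finset.disjoint_right, Finset.forall_mem_image]
    exact fun a ha => hyP a (Finset.mem_of_mem_erase ha)
  have := hd.card_le_succ p (P ∪ (P.erase p).image y) (by
    intro t ht htp
    rcases Finset.mem_union.1 ht with ht | ht
    · exact hP.isClique hp ht htp.symm
    · obtain ⟨a, ha, rfl⟩ := Finset.mem_image.1 ht
      exact (hyadj a (Finset.mem_of_mem_erase ha) p hp (Finset.ne_of_mem_erase ha).symm).symm)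
  rw [Finset.card_union_of_disjoint hdisj, Finset.card_image_of_injOn hinj,
    Finset.card_erase_of_mem hp, hP.card_eq] at this
  omega

end Cliques

section Reduction

variable {V : Type*} {G : SimpleGraph V} {q : ℕ} {P Q : Finset V}

/- A colour class consists of a vertex of `P` and its nonadjacent partner in `Q`, if any. The class
of `z` has no neighbours outside `P ∪ Q`, so all remaining vertices can be added to it. -/
theorem TwoK2Free.colorable_of_disjoint_cliques (hG : TwoK2Free G) (hd : DegreeAtMost G (q + 1))
    (hq : 4 ≤ q) (hP : G.IsNClique q P) (hQ : G.IsNClique q Q) (hPQ : Disjoint P Q) :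
    G.Colorable q := by
  classical
  obtain ⟨x₁, -, hx⟩ := hG.exists_forall_adj_mem_union hd hq hP hQ hPQ
  obtain ⟨y₁, hy₁, hy⟩ := hG.exists_forall_adj_mem_union hd hq hQ hP hPQ.symm
  obtain ⟨φ, hφ, hφP⟩ := hd.exists_injective_not_adj hq hP hQ hPQ
  obtain ⟨z, hzP, hz⟩ : ∃ z ∈ P, z ∉ ({x₁, φ ⟨y₁, hy₁⟩} : Finset V) :=
    Finset.exists_mem_notMem_of_card_lt_card (Finset.card_le_two.trans_lt (by
      rw [hP.card_eq]
      omega))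
  simp only [Finset.mem_insert, Finset.mem_singleton, not_or] at hz
  let X : P → Set V := fun p => insert p.1 (Subtype.val '' (φ ⁻¹' {p.1}))
  have hX : ∀ p, G.IsIndepSet (X p) := by
    rintro ⟨p, hp⟩
    refine Set.Pairwise.insert ?_ ?_
    · rintro _ ⟨y, hyp, rfl⟩ _ ⟨y', hyp', rfl⟩ hne
      exact absurd (congrArg Subtype.val (hφ (Eq.trans hyp (Eq.symm hyp')))) hne
    · rintro _ ⟨y, rfl, rfl⟩ -
      exact ⟨fun h => (hφP y).2 h.symm, (hφP y).2⟩
  have hcover : ∀ v ∉ {v | v ∉ P ∪ Q}, ∃ p, v ∈ X p := by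
    intro v hv
    rcases Finset.mem_union.1 (not_not.1 hv) with hvP | hvQ
    · exact ⟨⟨v, hvP⟩, .inl rfl⟩
    · exact ⟨⟨φ ⟨v, hvQ⟩, (hφP _).1⟩, .inr ⟨⟨v, hvQ⟩, rfl, rfl⟩⟩
  have hfree : ∀ r ∈ {v | v ∉ P ∪ Q}, ∃ p, ∀ w ∈ X p, ¬ G.Adj r w := by
    refine fun r hr => ⟨⟨z, hzP⟩, ?_⟩
    rintro w (rfl | ⟨y, rfl, rfl⟩) hrw
    · exact hr (hx w hzP hz.1 r hrw.symm)
    · exact hr (Finset.union_comm Q P ▸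
        hy y y.2 (fun hyy₁ => hz.2 (congrArg φ (Subtype.ext hyy₁))) r hrw.symm)
  obtain ⟨c⟩ := nonempty_coloring_of_isIndepSet hX (hG.isIndepSet_compl_union hq hP hx) hcover hfree
  simpa [hP.card_eq] using c.colorable

theorem DegreeAtMost.exists_mem_of_intersecting (hd : DegreeAtMost G (q + 1)) (hq : 4 ≤ q)
    (hf : G.CliqueFree (q + 1))
    (hint : ∀ P Q : Finset V, G.IsNClique q P → G.IsNClique q Q → ¬ Disjoint P Q)
    (hP : G.IsNClique q P) : ∃ v, ∀ Q, G.IsNClique q Q → v ∈ Q := by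
  classical
  by_cases hone : ∀ Q, G.IsNClique q Q → (P \ Q).card ≤ 1
  · exact hd.exists_mem_of_card_sdiff_le_one hq hf hP hone
  push Not at hone
  obtain ⟨Q, hQ, hPQ⟩ := hone
  obtain ⟨p, hp⟩ := Finset.not_disjoint_iff_nonempty_inter.1 (hint P Q hP hQ)
  have hcard : q + 2 ≤ (P ∪ Q).card := by
    rw [← Finset.card_sdiff_add_card, hQ.card_eq]
    omega
  exact ⟨p, fun R hR =>
    hd.mem_of_mem_inter hq hf hP hQ hcard hR (hint P R hP hR) (hint Q R hQ hR) hp⟩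

theorem TwoK2Free.colorable_or_exists_isIndepSet [Finite V] (hG : TwoK2Free G)
    (hd : DegreeAtMost G (q + 1)) (hq : 4 ≤ q) (hf : G.CliqueFree (q + 1)) :
    G.Colorable q ∨ ∃ I : Set V, G.IsIndepSet I ∧ (∀ v ∉ I, ∃ y ∈ I, G.Adj v y) ∧
      (G.induce Iᶜ).CliqueFree q := by
  rw [or_iff_not_imp_left]
  intro hcol
  obtain ⟨J, hJ, hJQ⟩ : ∃ J : Set V, J.Subsingleton ∧
      ∀ Q : Finset V, G.IsNClique q Q → ∃ v ∈ Q, v ∈ J := by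
    by_cases hex : ∃ P : Finset V, G.IsNClique q P
    · obtain ⟨P, hP⟩ := hex
      obtain ⟨v, hv⟩ := hd.exists_mem_of_intersecting hq hf (fun P Q hP hQ hPQ =>
        hcol (hG.colorable_of_disjoint_cliques hd hq hP hQ hPQ)) hP
      exact ⟨{v}, Set.subsingleton_singleton, fun Q hQ => ⟨v, hv Q hQ, rfl⟩⟩
    · exact ⟨∅, Set.subsingleton_empty, fun Q hQ => absurd ⟨Q, hQ⟩ hex⟩
  obtain ⟨I, hJI, hI, hdom⟩ := exists_isIndepSet_dominating (G := G) (hJ.pairwise _)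
  refine ⟨I, hI, hdom, fun t ht => ?_⟩
  obtain ⟨v, hv, hvJ⟩ := hJQ _ ((SimpleGraph.isNClique_induce_iff _ _ _).1 ht)
  obtain ⟨w, -, rfl⟩ := Finset.mem_map.1 hv
  exact w.2 (hJI hvJ)

end Reduction

section MainTheorem

universe u

theorem TwoK2Free.colorable_of_degreeAtMost_succ {q : ℕ} (hq : 4 ≤ q) :
    ∀ {V : Type u} [Finite V] {G : SimpleGraph V}, TwoK2Free G → DegreeAtMost G (q + 1) →
      G.CliqueFree (q + 1) → G.Colorable q := by
  induction q, hq using Nat.le_induction with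
  | base =>
    intro V _ G hG hd hf
    rcases hG.colorable_or_exists_isIndepSet hd le_rfl hf with hcol | ⟨I, hI, hdom, hIf⟩
    · exact hcol
    rcases (hG.induce Iᶜ).colorable_three_or_isExceptional (hd.induce_compl hdom) hIf with h | h
    · exact colorable_succ_of_induce_compl hI h
    · exact hG.colorable_four_of_isExceptional hd hI hdom h
  | succ q hq ih =>
    intro V _ G hG hd hf
    rcases hG.colorable_or_exists_isIndepSet hd (by omega) hf with hcol | ⟨I, hI, hdom, hIf⟩
    · exact hcol
    · exact colorable_succ_of_induce_compl hI (ih (hG.induce Iᶜ) (hd.induce_compl hdom) hIf)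

variable {V : Type*} {G : SimpleGraph V}

theorem IsExceptional.not_degreeAtMost_three (h : IsExceptional (G.induce G.support)) :
    ¬ DegreeAtMost G 3 := by
  intro hd
  have hdeg : ∀ {n : ℕ} {F : SimpleGraph (Fin n)} (i : Fin n) [Fintype (F.neighborSet i)],
      G.induce G.support ≃g F → F.degree i ≤ 3 := fun i _ e =>
    hd.degree_le_of_hom ((SimpleGraph.Embedding.induce _).comp e.symm.toEmbedding).toHom
      ((SimpleGraph.Embedding.induce _).comp e.symm.toEmbedding).injective i
  rcases h with ⟨⟨e⟩⟩ | ⟨⟨e⟩⟩ | ⟨⟨e⟩⟩ | ⟨⟨e⟩⟩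
  · exact absurd (hdeg 4 e) (by decide)
  · exact absurd (hdeg 4 e) (by decide)
  · exact absurd (hdeg 0 e) (by decide)
  · exact absurd (hdeg 4 e) (by decide)

variable [Finite V]

theorem cliqueFree_of_cliqueNum_lt {k : ℕ} (h : G.cliqueNum < k) : G.CliqueFree k :=
  fun _ hs => absurd (hs.card_eq ▸ hs.isClique.card_le_cliqueNum) h.not_ge

theorem two_le_cliqueNum_of_not_colorable (h : ¬ G.Colorable G.cliqueNum) : 2 ≤ G.cliqueNum := by
  classical
  have hne : G ≠ ⊥ := by
    rintro rfl
    have hcol : (⊥ : SimpleGraph V).Colorable 1 := ⟨SimpleGraph.Coloring.mk (fun _ => 0) nofun⟩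
    rcases isEmpty_or_nonempty V with _ | ⟨⟨v⟩⟩
    · exact h (.of_isEmpty _)
    · have hclique : (⊥ : SimpleGraph V).IsClique (({v} : Finset V) : Set V) := by simp
      exact h (hcol.mono hclique.card_le_cliqueNum)
  obtain ⟨u, v, huv⟩ := SimpleGraph.ne_bot_iff_exists_adj.1 hne
  have hclique : G.IsClique (({u, v} : Finset V) : Set V) := by simp [huv]
  simpa only [Finset.card_pair huv.ne] using hclique.card_le_cliqueNum

end MainTheorem

/-- In the second exception, `G.induce G.support` is `G` with its isolated vertices deleted
(it is `G` itself when `G` is connected). -/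
theorem mainTheorem3 {V : Type*} [Fintype V] (G : SimpleGraph V) [DecidableRel G.Adj]
    (hG : TwoK2Free G) :
    G.chromaticNumber ≤ ((max G.cliqueNum (G.maxDegree - 1) : ℕ) : ℕ∞) ∨
    (G.maxDegree ≤ 3 ∧ G.cliqueNum = 2 ∧ G.chromaticNumber = 3 ∧ HasInducedOddCycle G) ∨
    (G.maxDegree = 4 ∧ G.chromaticNumber = 4 ∧ G.cliqueNum = 3 ∧
      IsExceptional (G.induce G.support)) := by
  have hdeg : ∀ {k}, G.maxDegree ≤ k → DegreeAtMost G k := degreeAtMost_maxDegree.mono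
  rw [SimpleGraph.chromaticNumber_le_iff_colorable, or_iff_not_imp_left]
  intro hM
  have hω := two_le_cliqueNum_of_not_colorable fun h => hM (h.mono (le_max_left _ _))
  have hM3 : max G.cliqueNum (G.maxDegree - 1) ≤ 3 := by
    by_contra! h
    exact hM (hG.colorable_of_degreeAtMost_succ h (hdeg (by omega))
      (cliqueFree_of_cliqueNum_lt (by omega)))
  by_cases h3 : G.Colorable 3
  · have hM2 : max G.cliqueNum (G.maxDegree - 1) ≤ 2 := not_lt.1 fun h => hM (h3.mono h)
    have h2 : ¬ G.Colorable 2 := fun h => hM (h.mono (hω.trans (le_max_left _ _)))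
    have hC5 := not_imp_comm.1 (hG.colorable_two (cliqueFree_of_cliqueNum_lt (by omega))) h2
    exact .inl ⟨by omega, by omega,
      SimpleGraph.chromaticNumber_eq_iff_colorable_not_colorable.2 ⟨h3, h2⟩, 5, by decide,
      by decide, hC5⟩
  · have hexc := (hG.colorable_three_or_isExceptional (hdeg (by omega))
      (cliqueFree_of_cliqueNum_lt (by omega))).resolve_left h3
    have h4 : G.Colorable 4 := hG.colorable_of_degreeAtMost_succ le_rfl (hdeg (by omega))
      (cliqueFree_of_cliqueNum_lt (by omega))
    have hΔ := mt hdeg hexc.not_degreeAtMost_three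
    have hω3 := mt cliqueFree_of_cliqueNum_lt (mt hG.colorable_three_of_cliqueFree_three h3)
    exact .inr ⟨by omega, SimpleGraph.chromaticNumber_eq_iff_colorable_not_colorable.2 ⟨h4, h3⟩,
      by omega, hexc⟩
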